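/- Theorem 3.1. Let $B$ be a unital C*-algebra, let $\{A_i\}_{i\in I}$ be a family of unital C*-algebras indexed by a set $I$ of arbitrary cardinality, and let $\varepsilon_i : B \to A_i$ $(i \in I)$ be injective unital $*$-homomorphisms. Let $\mathcal{A}$ be the $*$-algebraic amalgamated free product, that is, the unital complex $*$-algebra generated by $B$ and the $A_i$ subject to the relations that the canonical maps $B \to \mathcal{A}$ and $\phi_i : A_i \to \mathcal{A}$ are unital $*$-homomorphisms and that $b = \phi_i(\varepsilon_i(b))$ for all $b\in B$, $i \in I$. Let the amalgamated free product C*-algebra $\ast_B A_i$ be the quotient completion of $\mathcal{A}$ with respect to the seminorm \[ \|x\| = \sup\{\|\pi(x)\| : \pi \text{ is a } *\text{-representation of } \mathcal{A} \text{ on a Hilbert space}\}, \] and denote the induced canonical $*$-homomorphisms $A_i \to \ast_B A_i$ again by $\phi_i$. Let $H$ be a complex Hilbert space and let $\Phi_i : A_i \to \mathcal{B}(H)$ $(i\in I)$ be unital completely positive maps that restrict to a common unital $*$-representation of $B$: there is a unital $*$-representation $\rho : B \to \mathcal{B}(H)$ with $\Phi_i\circ\varepsilon_i = \rho$ for all $i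 \in I$. Then there is a unital completely positive map $\Phi : \ast_B A_i \to \mathcal{B}(H)$ such that $\Phi\circ\phi_i = \Phi_i$ for all $i\in I$. (No conditional expectations $A_i \to B$ are assumed.) -/

import Mathlib

universe uI uB uA uH

namespace CStarAmalgam

section

variable {I : Type uI} {B : Type uB} [CStarAlgebra B] {A : I → Type uA}
  [∀ i, CStarAlgebra (A i)] (ε : ∀ i, B →⋆ₐ[ℂ] A i)

/-- The free unital complex algebra on the disjoint union of the sets `B` and `A i`, `i ∈ I`. -/
abbrev Pre (_ : ∀ i, B →⋆ₐ[ℂ] A i) : Type (max uI uB uA) :=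
  FreeAlgebra ℂ (B ⊕ (Σ i, A i))

/-- The generator of the free algebra given by an element of `B`. -/
noncomputable def genB (b : B) : Pre ε := FreeAlgebra.ι ℂ (Sum.inl b)

/-- The generator of the free algebra given by an element of `A i`. -/
noncomputable def genA (i : I) (a : A i) : Pre ε := FreeAlgebra.ι ℂ (Sum.inr ⟨i, a⟩)

/-- The relations of the amalgamated free product: the maps `B → Pre ε` and `A i → Pre ε` become
homomorphisms of unital algebras, and each `b ∈ B` is identified with all of its images `ε i b`. -/
inductive Rel : Pre ε → Pre ε → Prop
  | algebraMapB (z : ℂ) : Rel (genB ε (algebraMap ℂ B z)) (algebraMap ℂ (Pre ε) z)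
  | addB (b c : B) : Rel (genB ε (b + c)) (genB ε b + genB ε c)
  | mulB (b c : B) : Rel (genB ε (b * c)) (genB ε b * genB ε c)
  | algebraMapA (i : I) (z : ℂ) :
      Rel (genA ε i (algebraMap ℂ (A i) z)) (algebraMap ℂ (Pre ε) z)
  | addA (i : I) (a c : A i) : Rel (genA ε i (a + c)) (genA ε i a + genA ε i c)
  | mulA (i : I) (a c : A i) : Rel (genA ε i (a * c)) (genA ε i a * genA ε i c)
  | amalg (i : I) (b : B) : Rel (genA ε i (ε i b)) (genB ε b)

/-- The algebraic amalgamated free product of the `A i` over `B` (the pushout in the category of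
unital complex algebras). -/
def AlgAmalg : Type (max uI uB uA) := RingQuot (Rel ε)

noncomputable instance : Ring (AlgAmalg ε) := inferInstanceAs (Ring (RingQuot (Rel ε)))

noncomputable instance : Algebra ℂ (AlgAmalg ε) :=
  inferInstanceAs (Algebra ℂ (RingQuot (Rel ε)))

/-- The quotient map from the free algebra. -/
noncomputable def mk : Pre ε →ₐ[ℂ] AlgAmalg ε := RingQuot.mkAlgHom ℂ (Rel ε)

theorem mk_surjective : Function.Surjective (mk ε) := RingQuot.mkAlgHom_surjective ℂ (Rel ε)

theorem mk_rel {x y : Pre ε} (h : Rel ε x y) : mk ε x = mk ε y := RingQuot.mkAlgHom_rel ℂ h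

/-- The canonical homomorphism from `B` to the algebraic amalgamated free product. -/
noncomputable def algOfB : B →ₐ[ℂ] AlgAmalg ε :=
  AlgHom.ofLinearMap
    { toFun := fun b => mk ε (genB ε b)
      map_add' := fun b c => by rw [mk_rel ε (.addB b c), map_add]
      map_smul' := fun z b => by
        rw [Algebra.smul_def, mk_rel ε (.mulB _ b), map_mul, mk_rel ε (.algebraMapB z),
          AlgHom.commutes, RingHom.id_apply, Algebra.smul_def] }
    (by
      have h := mk_rel ε (.algebraMapB 1)
      rw [map_one, map_one, map_one] at h
      exact h)
    (fun b c => by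
      change mk ε (genB ε (b * c)) = mk ε (genB ε b) * mk ε (genB ε c)
      rw [mk_rel ε (.mulB b c), map_mul])

/-- The canonical homomorphism from `A i` to the algebraic amalgamated free product. -/
noncomputable def algOf (i : I) : A i →ₐ[ℂ] AlgAmalg ε :=
  AlgHom.ofLinearMap
    { toFun := fun a => mk ε (genA ε i a)
      map_add' := fun b c => by rw [mk_rel ε (.addA i b c), map_add]
      map_smul' := fun z b => by
        rw [Algebra.smul_def, mk_rel ε (.mulA i _ b), map_mul, mk_rel ε (.algebraMapA i z),
          AlgHom.commutes, RingHom.id_apply, Algebra.smul_def] }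
    (by
      have h := mk_rel ε (.algebraMapA i 1)
      rw [map_one, map_one, map_one] at h
      exact h)
    (fun b c => by
      change mk ε (genA ε i (b * c)) = mk ε (genA ε i b) * mk ε (genA ε i c)
      rw [mk_rel ε (.mulA i b c), map_mul])

theorem algOf_apply_amalg (i : I) (b : B) : algOf ε i (ε i b) = algOfB ε b :=
  mk_rel ε (.amalg i b)

/-- The induction principle: the algebraic amalgamated free product is generated by the images of
`B` and of the `A i`. -/
theorem AlgAmalg.induction {p : AlgAmalg ε → Prop} (scalar : ∀ z : ℂ, p (algebraMap ℂ _ z))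
    (ofB : ∀ b, p (algOfB ε b)) (ofA : ∀ i a, p (algOf ε i a))
    (mul : ∀ x y, p x → p y → p (x * y)) (add : ∀ x y, p x → p y → p (x + y))
    (x : AlgAmalg ε) : p x := by
  obtain ⟨x, rfl⟩ := mk_surjective ε x
  induction x using FreeAlgebra.induction with
  | grade0 z => rw [AlgHom.commutes]; exact scalar z
  | grade1 g =>
    rcases g with b | ⟨i, a⟩
    · exact ofB b
    · exact ofA i a
  | mul x y hx hy => rw [map_mul]; exact mul _ _ hx hy
  | add x y hx hy => rw [map_add]; exact add _ _ hx hy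

/-- The opposite algebra of `AlgAmalg ε` with conjugated scalar multiplication; an algebra
homomorphism into it is a conjugate-linear antimultiplicative map into `AlgAmalg ε`. -/
def ConjOp : Type (max uI uB uA) := (AlgAmalg ε)ᵐᵒᵖ

noncomputable instance : Ring (ConjOp ε) := inferInstanceAs (Ring (AlgAmalg ε)ᵐᵒᵖ)

noncomputable instance : Algebra ℂ (ConjOp ε) :=
  Algebra.compHom (AlgAmalg ε)ᵐᵒᵖ (starRingEnd ℂ)

/-- The map sending the generator `a` to the generator `star a`. -/
noncomputable def preStarHom : Pre ε →ₐ[ℂ] ConjOp ε :=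
  FreeAlgebra.lift ℂ (fun g => (MulOpposite.op (Sum.elim (fun b => algOfB ε (star b))
    (fun s => algOf ε s.1 (star s.2)) g) : (AlgAmalg ε)ᵐᵒᵖ))

theorem preStarHom_genB (b : B) :
    preStarHom ε (genB ε b) = MulOpposite.op (algOfB ε (star b)) := by
  simp only [preStarHom, genB]
  exact FreeAlgebra.lift_ι_apply _ _

theorem preStarHom_genA (i : I) (a : A i) :
    preStarHom ε (genA ε i a) = MulOpposite.op (algOf ε i (star a)) := by
  simp only [preStarHom, genA]
  exact FreeAlgebra.lift_ι_apply _ _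

theorem preStarHom_algebraMap (z : ℂ) :
    preStarHom ε (algebraMap ℂ _ z) = MulOpposite.op (algebraMap ℂ (AlgAmalg ε) (star z)) :=
  AlgHom.commutes _ z

theorem preStarHom_rel {x y : Pre ε} (h : Rel ε x y) : preStarHom ε x = preStarHom ε y := by
  cases h with
  | algebraMapB z =>
    rw [preStarHom_algebraMap, preStarHom_genB, ← algebraMap_star_comm, AlgHom.commutes]
  | addB b c =>
    rw [map_add, preStarHom_genB, preStarHom_genB, preStarHom_genB, star_add, map_add]; rfl
  | mulB b c =>
    rw [map_mul, preStarHom_genB, preStarHom_genB, preStarHom_genB, star_mul, map_mul]; rfl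
  | algebraMapA i z =>
    rw [preStarHom_algebraMap, preStarHom_genA, ← algebraMap_star_comm, AlgHom.commutes]
  | addA i b c =>
    rw [map_add, preStarHom_genA, preStarHom_genA, preStarHom_genA, star_add, map_add]; rfl
  | mulA i b c =>
    rw [map_mul, preStarHom_genA, preStarHom_genA, preStarHom_genA, star_mul, map_mul]; rfl
  | amalg i b =>
    rw [preStarHom_genA, preStarHom_genB, ← map_star, algOf_apply_amalg]

/-- The involution of the algebraic amalgamated free product, as a homomorphism to the opposite
algebra. -/
noncomputable def starHom : AlgAmalg ε →ₐ[ℂ] ConjOp ε :=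
  RingQuot.liftAlgHom ℂ ⟨preStarHom ε, fun _ _ h => preStarHom_rel ε h⟩

theorem starHom_mk (x : Pre ε) : starHom ε (mk ε x) = preStarHom ε x :=
  RingQuot.liftAlgHom_mkAlgHom_apply ℂ _ _ x

noncomputable instance : Star (AlgAmalg ε) := ⟨fun x => MulOpposite.unop (starHom ε x)⟩

theorem star_algOfB (b : B) : star (algOfB ε b) = algOfB ε (star b) := by
  change MulOpposite.unop (starHom ε (mk ε (genB ε b))) = _
  rw [starHom_mk, preStarHom_genB, MulOpposite.unop_op]

theorem star_algOf (i : I) (a : A i) : star (algOf ε i a) = algOf ε i (star a) := by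
  change MulOpposite.unop (starHom ε (mk ε (genA ε i a))) = _
  rw [starHom_mk, preStarHom_genA, MulOpposite.unop_op]

theorem star_algebraMap' (z : ℂ) :
    star (algebraMap ℂ (AlgAmalg ε) z) = algebraMap ℂ (AlgAmalg ε) (star z) := by
  change MulOpposite.unop (starHom ε (algebraMap ℂ (AlgAmalg ε) z)) = _
  rw [AlgHom.commutes]
  rfl

theorem star_add' (x y : AlgAmalg ε) : star (x + y) = star x + star y := by
  change MulOpposite.unop (starHom ε (x + y)) = _
  rw [map_add]; rfl

theorem star_mul' (x y : AlgAmalg ε) : star (x * y) = star y * star x := by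
  change MulOpposite.unop (starHom ε (x * y)) = _
  rw [map_mul]; rfl

theorem star_star' (x : AlgAmalg ε) : star (star x) = x := by
  induction x using AlgAmalg.induction with
  | scalar z => rw [star_algebraMap', star_algebraMap', star_star]
  | ofB b => rw [star_algOfB, star_algOfB, star_star]
  | ofA i a => rw [star_algOf, star_algOf, star_star]
  | mul x y hx hy => rw [star_mul', star_mul', hx, hy]
  | add x y hx hy => rw [star_add', star_add', hx, hy]

/-- The algebraic amalgamated free product is a `*`-algebra. -/
noncomputable instance : StarRing (AlgAmalg ε) where
  star_involutive := star_star' ε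
  star_mul := star_mul' ε
  star_add := star_add' ε

instance : StarModule ℂ (AlgAmalg ε) where
  star_smul z x := by
    rw [Algebra.smul_def, star_mul, star_algebraMap', Algebra.smul_def, Algebra.commutes]

/-- The canonical `*`-homomorphism from `B` to the algebraic amalgamated free product. -/
noncomputable def algOfBStar : B →⋆ₐ[ℂ] AlgAmalg ε :=
  { algOfB ε with map_star' := fun b => (star_algOfB ε b).symm }

/-- The canonical `*`-homomorphism from `A i` to the algebraic amalgamated free product. -/
noncomputable def algOfStar (i : I) : A i →⋆ₐ[ℂ] AlgAmalg ε :=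
  { algOf ε i with map_star' := fun a => (star_algOf ε i a).symm }

/-- A (unital) `*`-representation of the algebraic amalgamated free product on a Hilbert space.
The universe of the Hilbert space is that of the algebra, hence is large enough for all cyclic
representations. -/
structure Rep where
  /-- The Hilbert space. -/
  space : Type (max uI uB uA)
  [normed : NormedAddCommGroup space]
  [inner : InnerProductSpace ℂ space]
  [complete : CompleteSpace space]
  /-- The representation. -/
  hom : AlgAmalg ε →⋆ₐ[ℂ] (space →L[ℂ] space)

attribute [instance] Rep.normed Rep.inner Rep.complete

/-- The representation on the zero space. -/
noncomputable instance : Inhabited (Rep ε) where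
  default :=
    { space := PUnit
      hom :=
        { toFun := fun _ => 0
          map_one' := Subsingleton.elim _ _
          map_mul' := fun _ _ => Subsingleton.elim _ _
          map_zero' := rfl
          map_add' := fun _ _ => Subsingleton.elim _ _
          commutes' := fun _ => Subsingleton.elim _ _
          map_star' := fun _ => Subsingleton.elim _ _ } }

theorem exists_bound (x : AlgAmalg ε) : ∃ C : ℝ, ∀ π : Rep ε, ‖π.hom x‖ ≤ C := by
  induction x using AlgAmalg.induction with
  | scalar z =>
    refine ⟨‖z‖, fun π => ?_⟩
    rw [AlgHomClass.commutes, Algebra.algebraMap_eq_smul_one]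
    refine (norm_smul_le _ _).trans ?_
    exact mul_le_of_le_one_right (norm_nonneg _) ContinuousLinearMap.norm_id_le
  | ofB b =>
    exact ⟨‖b‖, fun π => NonUnitalStarAlgHom.norm_apply_le (π.hom.comp (algOfBStar ε)) b⟩
  | ofA i a =>
    exact ⟨‖a‖, fun π => NonUnitalStarAlgHom.norm_apply_le (π.hom.comp (algOfStar ε i)) a⟩
  | mul x y hx hy =>
    obtain ⟨C, hC⟩ := hx
    obtain ⟨D, hD⟩ := hy
    refine ⟨C * D, fun π => ?_⟩
    rw [map_mul]
    exact (norm_mul_le _ _).trans (mul_le_mul (hC π) (hD π) (norm_nonneg _)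
      ((norm_nonneg _).trans (hC π)))
  | add x y hx hy =>
    obtain ⟨C, hC⟩ := hx
    obtain ⟨D, hD⟩ := hy
    refine ⟨C + D, fun π => ?_⟩
    rw [map_add]
    exact (norm_add_le _ _).trans (add_le_add (hC π) (hD π))

theorem bddAbove_range (x : AlgAmalg ε) :
    BddAbove (Set.range fun π : Rep ε => ‖π.hom x‖) := by
  obtain ⟨C, hC⟩ := exists_bound ε x
  exact ⟨C, by rintro _ ⟨π, rfl⟩; exact hC π⟩

/-- The seminorm `‖x‖ = sup {‖π x‖ : π a *-representation}`. -/
noncomputable def univSeminorm : RingSeminorm (AlgAmalg ε) where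
  toFun x := ⨆ π : Rep ε, ‖π.hom x‖
  map_zero' := by simp
  add_le' x y := ciSup_le fun π => by
    rw [map_add]
    exact (norm_add_le _ _).trans
      (add_le_add (le_ciSup (bddAbove_range ε x) π) (le_ciSup (bddAbove_range ε y) π))
  neg' x := by simp
  mul_le' x y := ciSup_le fun π => by
    rw [map_mul]
    exact (norm_mul_le _ _).trans
      (mul_le_mul (le_ciSup (bddAbove_range ε x) π) (le_ciSup (bddAbove_range ε y) π)
        (norm_nonneg _) (Real.iSup_nonneg fun _ => norm_nonneg _))

noncomputable instance : SeminormedRing (AlgAmalg ε) := (univSeminorm ε).toSeminormedRing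

theorem norm_def (x : AlgAmalg ε) : ‖x‖ = ⨆ π : Rep ε, ‖π.hom x‖ := rfl

theorem norm_rep_le (π : Rep ε) (x : AlgAmalg ε) : ‖π.hom x‖ ≤ ‖x‖ :=
  le_ciSup (bddAbove_range ε x) π

noncomputable instance : NormedAlgebra ℂ (AlgAmalg ε) where
  norm_smul_le z x := ciSup_le fun π => by
    rw [map_smul]
    exact (norm_smul_le _ _).trans
      (mul_le_mul_of_nonneg_left (norm_rep_le ε π x) (norm_nonneg _))

theorem norm_star' (x : AlgAmalg ε) : ‖star x‖ = ‖x‖ := by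
  simp only [norm_def, map_star, norm_star]

theorem norm_mul_self_le' (x : AlgAmalg ε) : ‖x‖ * ‖x‖ ≤ ‖star x * x‖ := by
  have h : ‖x‖ ≤ √‖star x * x‖ := ciSup_le fun π => by
    refine Real.le_sqrt_of_sq_le ?_
    have h := norm_rep_le ε π (star x * x)
    rwa [map_mul, map_star, CStarRing.norm_star_mul_self, ← sq] at h
  calc ‖x‖ * ‖x‖ ≤ √‖star x * x‖ * √‖star x * x‖ :=
        mul_self_le_mul_self (norm_nonneg _) h
    _ = ‖star x * x‖ := Real.mul_self_sqrt (norm_nonneg _)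

/-- The amalgamated free product C*-algebra: the quotient completion of the algebraic amalgamated
free product with respect to its universal seminorm. -/
def FreeProd : Type (max uI uB uA) := UniformSpace.Completion (AlgAmalg ε)

open UniformSpace

noncomputable instance : NormedRing (FreeProd ε) :=
  inferInstanceAs (NormedRing (Completion (AlgAmalg ε)))

noncomputable instance : Algebra ℂ (FreeProd ε) :=
  inferInstanceAs (Algebra ℂ (Completion (AlgAmalg ε)))

noncomputable instance : NormedAlgebra ℂ (FreeProd ε) where
  norm_smul_le := fun (z : ℂ) (x : Completion (AlgAmalg ε)) => norm_smul_le z x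

instance : CompleteSpace (FreeProd ε) :=
  inferInstanceAs (CompleteSpace (Completion (AlgAmalg ε)))

/-- The canonical map from the algebraic amalgamated free product to its completion. -/
noncomputable def toFreeProd : AlgAmalg ε →ₐ[ℂ] FreeProd ε where
  __ := (Completion.coeRingHom : AlgAmalg ε →+* Completion (AlgAmalg ε))
  commutes' _ := rfl

theorem norm_toFreeProd (x : AlgAmalg ε) : ‖toFreeProd ε x‖ = ‖x‖ := Completion.norm_coe x

theorem denseRange_toFreeProd : DenseRange (toFreeProd ε) := Completion.denseRange_coe

theorem isometry_star : Isometry (star : AlgAmalg ε → AlgAmalg ε) :=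
  Isometry.of_dist_eq fun x y => by
    rw [dist_eq_norm, dist_eq_norm, ← star_sub, norm_star']

/-- The involution is extended by continuity. -/
noncomputable instance : Star (FreeProd ε) :=
  ⟨Completion.map (star : AlgAmalg ε → AlgAmalg ε)⟩

theorem continuous_star' : Continuous (star : FreeProd ε → FreeProd ε) := Completion.continuous_map

theorem star_toFreeProd (x : AlgAmalg ε) : star (toFreeProd ε x) = toFreeProd ε (star x) :=
  Completion.map_coe (isometry_star ε).uniformContinuous x

noncomputable instance : StarRing (FreeProd ε) where
  star_involutive x := by
    have hs := continuous_star' ε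
    induction x using (denseRange_toFreeProd ε).induction_on with
    | hp => exact isClosed_eq (hs.comp hs) continuous_id
    | ih x => rw [star_toFreeProd, star_toFreeProd, star_star]
  star_mul x y := by
    have hs := continuous_star' ε
    induction x, y using (denseRange_toFreeProd ε).induction_on₂ with
    | hp => exact isClosed_eq (by fun_prop) (by fun_prop)
    | h x y => rw [← map_mul, star_toFreeProd, star_toFreeProd, star_toFreeProd, star_mul, map_mul]
  star_add x y := by
    have hs := continuous_star' ε
    induction x, y using (denseRange_toFreeProd ε).induction_on₂ with
    | hp => exact isClosed_eq (by fun_prop) (by fun_prop)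
    | h x y => rw [← map_add, star_toFreeProd, star_toFreeProd, star_toFreeProd, star_add, map_add]

instance : CStarRing (FreeProd ε) where
  norm_mul_self_le x := by
    have hs := continuous_star' ε
    induction x using (denseRange_toFreeProd ε).induction_on with
    | hp => exact isClosed_le (by fun_prop) (by fun_prop)
    | ih x =>
      rw [star_toFreeProd, ← map_mul, norm_toFreeProd, norm_toFreeProd]
      exact norm_mul_self_le' ε x

instance : StarModule ℂ (FreeProd ε) where
  star_smul z x := by
    have h : star (algebraMap ℂ (FreeProd ε) z) = algebraMap ℂ (FreeProd ε) (star z) := by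
      rw [← AlgHom.commutes (toFreeProd ε), star_toFreeProd, star_algebraMap', AlgHom.commutes]
    rw [Algebra.smul_def, star_mul, h, Algebra.smul_def, Algebra.commutes]

/-- The amalgamated free product is a unital C*-algebra. -/
noncomputable instance : CStarAlgebra (FreeProd ε) where

/-- The order of the C*-algebra (the only one that makes it a star-ordered ring). -/
noncomputable instance : PartialOrder (FreeProd ε) := CStarAlgebra.spectralOrder (FreeProd ε)

instance : StarOrderedRing (FreeProd ε) := CStarAlgebra.spectralOrderedRing (FreeProd ε)

/-- The canonical unital `*`-homomorphism from `A i` to the amalgamated free product. -/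
noncomputable def of (i : I) : A i →⋆ₐ[ℂ] FreeProd ε :=
  { (toFreeProd ε).comp (algOf ε i) with
    map_star' := fun a => by
      change toFreeProd ε (algOf ε i (star a)) = star (toFreeProd ε (algOf ε i a))
      rw [star_toFreeProd, star_algOf] }

end

end CStarAmalgam

/-! The maps `Φ i` are realised as corners of one representation of the free product. Stinespring
gives a representation `P i` of `A i` and an isometry `V i` on `H`. Since `Φ i` restricts to the
homomorphism `ρ` on `B`, `V i` intertwines `ρ` with the restriction of `P i`
(`dilation_equivariant`), so its range reduces `B`, and the restriction of `P i` to `B` is `ρ` plus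
a complementary representation.

The complement for `A i` carries no action of the other algebras. This is repaired inductively: any
representation `X` of `B` sits in the restriction of some representation of `A i`
(`exists_extension_rep`: extend vector functionals, apply GNS, take direct sums), leaving a new
complement. Iterating over words without equal neighbours gives representations `X w` of `B`, with
`ρ` at the empty word and `X (i :: w)` the complement of `X w` in its dilation to `A i`.

On the Hilbert sum of all `X w`, fix `i`. The words split into pairs `w`, `i :: w` with `w` not
beginning with `i`, and each `X w ⊕ X (i :: w)` is the space of a representation of `A i`. So every
`A i` acts, and all of them restrict to the same diagonal action of `B` (`exists_glued_reps`). Only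
existence of complements is used, hence no conditional expectations. The universal property gives a
representation of the free product; its compression to `H` is completely positive, and equals `Φ i`
on `A i` because `P i` sits inside the sum at the empty word. -/

section

open scoped InnerProductSpace ComplexOrder CStarAlgebra

universe uK uR

namespace CStarAmalgam

/-! ### Hilbert spaces and representations built from total families. -/

section HilbertTools

variable {L : Type*} [NormedAddCommGroup L] [InnerProductSpace ℂ L]

theorem inner_linearCombination {X : Type*} (u : X → L) (f g : X →₀ ℂ) :
    ⟪Finsupp.linearCombination ℂ u f, Finsupp.linearCombination ℂ u g⟫_ℂ =
      f.sum fun x z => g.sum fun y w => star z * w * ⟪u x, u y⟫_ℂ := by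
  simp only [Finsupp.linearCombination_apply, Finsupp.sum]
  rw [sum_inner]
  refine Finset.sum_congr rfl fun x _ => ?_
  rw [inner_sum]
  refine Finset.sum_congr rfl fun y _ => ?_
  rw [inner_smul_left, inner_smul_right, mul_assoc]
  rfl

theorem denseRange_linearCombination {X : Type*} {u : X → L}
    (hu : (Submodule.span ℂ (Set.range u)).topologicalClosure = ⊤) :
    DenseRange (Finsupp.linearCombination ℂ u) := by
  rw [DenseRange, ← LinearMap.coe_range, Finsupp.range_linearCombination]
  exact Submodule.dense_iff_topologicalClosure_eq_top.mpr hu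

variable {K : Type*} [NormedAddCommGroup K] [InnerProductSpace ℂ K] [CompleteSpace K]

/-- Two families with the same Gram matrix, the first one total, are related by an isometry. -/
theorem exists_isometry_of_inner_eq {X : Type*} (u : X → L) (v : X → K)
    (hu : (Submodule.span ℂ (Set.range u)).topologicalClosure = ⊤)
    (h : ∀ x y, ⟪u x, u y⟫_ℂ = ⟪v x, v y⟫_ℂ) :
    ∃ V : L →ₗᵢ[ℂ] K, ∀ x, V (u x) = v x := by
  have hd := denseRange_linearCombination hu
  have hn (f : X →₀ ℂ) :
      ‖Finsupp.linearCombination ℂ v f‖ = ‖Finsupp.linearCombination ℂ u f‖ := by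
    rw [← sq_eq_sq₀ (norm_nonneg _) (norm_nonneg _), ← inner_self_eq_norm_sq (𝕜 := ℂ),
      ← inner_self_eq_norm_sq (𝕜 := ℂ), inner_linearCombination, inner_linearCombination]
    simp only [h]
  have hn' : ∃ C, ∀ f, ‖Finsupp.linearCombination ℂ v f‖ ≤
      C * ‖Finsupp.linearCombination ℂ u f‖ := ⟨1, fun f => by rw [hn, one_mul]⟩
  let T := (Finsupp.linearCombination ℂ v).extendOfNorm (Finsupp.linearCombination ℂ u)
  have hT f : T (Finsupp.linearCombination ℂ u f) = Finsupp.linearCombination ℂ v f :=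
    LinearMap.extendOfNorm_eq hd hn' f
  refine ⟨⟨T.toLinearMap, fun y => ?_⟩, fun x => ?_⟩
  · change ‖T y‖ = ‖y‖
    induction y using hd.induction_on with
    | hp => exact isClosed_eq (by fun_prop) (by fun_prop)
    | ih f => rw [hT, hn]
  · simpa using hT (Finsupp.single x 1)

variable [CompleteSpace L]

/-- The Hilbert space of a positive semidefinite operator-valued kernel. -/
theorem exists_space_of_kernel {X : Type uA} {V : Type uH} [NormedAddCommGroup V]
    [InnerProductSpace ℂ V] [CompleteSpace V] (k : X → X → (V →L[ℂ] V))
    (hk : ∀ x y, star (k x y) = k y x)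
    (hpos : ∀ f : X →₀ V, 0 ≤ (f.sum fun x v => f.sum fun y w => ⟪k y x v, w⟫_ℂ).re) :
    ∃ (S : Type (max uA uH)) (_ : NormedAddCommGroup S) (_ : InnerProductSpace ℂ S)
      (_ : CompleteSpace S) (j : X → V →L[ℂ] S),
      (∀ x y v w, ⟪j x v, j y w⟫_ℂ = ⟪v, k x y w⟫_ℂ) ∧
      (Submodule.span ℂ (Set.range fun p : X × V => j p.1 p.2)).topologicalClosure = ⊤ := by
  -- The space is the reproducing kernel Hilbert space of `k`, and `j` sends a point and a vector to
  -- the corresponding kernel function.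
  have hp : (Matrix.of k).PosSemidef :=
    ((RKHS.posSemidef_tfae (K := Matrix.of k)).out 0 2 :
      _ ↔ (Matrix.of k).IsHermitian ∧ _).mpr ⟨Matrix.IsHermitian.ext fun x y => hk y x, hpos⟩
  have : Fact (Matrix.of k).PosSemidef := ⟨hp⟩
  refine ⟨RKHS.OfKernel (Matrix.of k), inferInstance, inferInstance, inferInstance,
    RKHS.kerFun (RKHS.OfKernel (Matrix.of k)), fun x y v w => ?_, ?_⟩
  · have h := RKHS.kernel_inner (RKHS.OfKernel (Matrix.of k)) y x v w
    rw [RKHS.OfKernel.kernel_ofKernel] at h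
    rw [← h, Matrix.of_apply, ← hk x y, ContinuousLinearMap.star_eq_adjoint,
      ContinuousLinearMap.adjoint_inner_left]
  · rw [← RKHS.kerFun_dense (RKHS.OfKernel (Matrix.of k))]
    congr 2
    ext s
    simp

/-- A representation of a unital C*-algebra is given by an action on a dense subspace that is
compatible with the involution; boundedness is automatic. -/
theorem exists_rep_of_dense {A : Type*} [CStarAlgebra A] {D : Type*} [AddCommGroup D] [Module ℂ D]
    (e : D →ₗ[ℂ] K) (he : DenseRange e) (m : A → D →ₗ[ℂ] D)
    (hone : ∀ x, e (m 1 x) = e x) (hmul : ∀ a b x, e (m (a * b) x) = e (m a (m b x)))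
    (hadd : ∀ a b x, e (m (a + b) x) = e (m a x) + e (m b x))
    (hsmul : ∀ (z : ℂ) a x, e (m (z • a) x) = z • e (m a x))
    (hstar : ∀ a x y, ⟪e (m a x), e y⟫_ℂ = ⟪e x, e (m (star a) y)⟫_ℂ) :
    ∃ π : A →⋆ₐ[ℂ] (K →L[ℂ] K), ∀ a x, π a (e x) = e (m a x) := by
  let _ := CStarAlgebra.spectralOrder A
  have := CStarAlgebra.spectralOrderedRing A
  have hsq (a : A) (x : D) : ‖e (m a x)‖ ^ 2 = (⟪e x, e (m (star a * a) x)⟫_ℂ).re := by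
    rw [hmul, ← hstar, ← inner_self_eq_norm_sq (𝕜 := ℂ)]
    rfl
  -- Write `‖a‖² - a* a = c* c`; then `‖a‖² ‖e x‖²` is the sum of the squared norms of `e (m c x)`
  -- and `e (m a x)`.
  have hb (a : A) (x : D) : ‖e (m a x)‖ ≤ ‖a‖ * ‖e x‖ := by
    obtain ⟨c, hc⟩ := CStarAlgebra.nonneg_iff_eq_star_mul_self.mp
      (sub_nonneg.mpr (CStarAlgebra.star_mul_le_algebraMap_norm_sq (a := a)))
    have h1 : ((‖a‖ ^ 2 : ℝ) : ℂ) • (1 : A) = star c * c + star a * a := by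
      rw [← hc, sub_add_cancel, Algebra.algebraMap_eq_smul_one]; exact Complex.coe_smul _ _
    have h2 : ‖a‖ ^ 2 * ‖e x‖ ^ 2 = ‖e (m c x)‖ ^ 2 + ‖e (m a x)‖ ^ 2 := by
      rw [hsq, hsq, ← Complex.add_re, ← inner_add_right, ← hadd, ← h1, hsmul, hone,
        inner_smul_right, Complex.re_ofReal_mul,
        ← inner_self_eq_norm_sq (𝕜 := ℂ) (e x)]
      rfl
    rw [← sq_le_sq₀ (norm_nonneg _) (by positivity), mul_pow, h2]
    exact le_add_of_nonneg_left (sq_nonneg _)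
  let T (a : A) : K →L[ℂ] K := (e ∘ₗ m a).extendOfNorm e
  have hT a x : T a (e x) = e (m a x) := LinearMap.extendOfNorm_eq he ⟨‖a‖, hb a⟩ x
  have hext {S S' : K →L[ℂ] K} (h : ∀ x, S (e x) = S' (e x)) : S = S' :=
    ContinuousLinearMap.coeFn_injective
      (he.equalizer S.continuous S'.continuous (funext h))
  have hTsmul (z : ℂ) a : T (z • a) = z • T a := hext fun x => by simp [hT, hsmul]
  have hTone : T 1 = 1 := hext fun x => by simp [hT, hone]
  refine ⟨{ toFun := T, map_one' := hTone,
            map_mul' := fun a b => hext fun x => by simp [hT, hmul]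
            map_zero' := by simpa using hTsmul 0 0
            map_add' := fun a b => hext fun x => by simp [hT, hadd]
            commutes' := fun z => by
              rw [Algebra.algebraMap_eq_smul_one, hTsmul, hTone, Algebra.algebraMap_eq_smul_one]
            map_star' := fun a => by
              rw [ContinuousLinearMap.star_eq_adjoint, ContinuousLinearMap.eq_adjoint_iff]
              intro x y
              induction x, y using he.induction_on₂ with
              | hp => exact isClosed_eq (by fun_prop) (by fun_prop)
              | h x y => rw [hT, hT, hstar, star_star] }, hT⟩

/-- A representation restricts to an invariant subspace, given as the range of an isometry. -/
theorem exists_rep_restrict {R : Type*} [Ring R] [StarRing R] [Algebra ℂ R]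
    (π : R →⋆ₐ[ℂ] (K →L[ℂ] K)) (W : L →ₗᵢ[ℂ] K) (h : ∀ r y, ∃ z, π r (W y) = W z) :
    ∃ π' : R →⋆ₐ[ℂ] (L →L[ℂ] L), ∀ r y, W (π' r y) = π r (W y) := by
  let V : L →L[ℂ] K := W.toContinuousLinearMap
  have hV y : V y = W y := rfl
  have hVV y : V.adjoint (W y) = y := by
    refine ext_inner_right ℂ fun z => ?_
    rw [ContinuousLinearMap.adjoint_inner_left, hV, W.inner_map_map]
  let T (r : R) : L →L[ℂ] L := V.adjoint ∘L π r ∘L V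
  have hT r y : W (T r y) = π r (W y) := by
    -- Invariance puts `π r (W y)` in the range of `W`, where `V V*` is the identity.
    obtain ⟨z, hz⟩ := h r y
    change W (V.adjoint (π r (W y))) = _
    rw [hz, hVV]
  have hext {S S' : L →L[ℂ] L} (h : ∀ x, W (S x) = W (S' x)) : S = S' :=
    ContinuousLinearMap.ext fun x => W.injective (h x)
  refine ⟨{ toFun := T
            map_one' := hext fun x => by simp [hT]
            map_mul' := fun a b => hext fun x => by simp [hT]
            map_zero' := hext fun x => by simp [hT]
            map_add' := fun a b => hext fun x => by simp [hT]
            commutes' := fun z => hext fun x => by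
              simp [hT, Algebra.algebraMap_eq_smul_one]
            map_star' := fun a => by
              simp [T, ContinuousLinearMap.star_eq_adjoint,
                ContinuousLinearMap.adjoint_comp, map_star, ContinuousLinearMap.comp_assoc] }, hT⟩

/-- The direct sum of representations of a unital C*-algebra. -/
theorem exists_rep_directSum {A : Type*} [CStarAlgebra A] {ι : Type*} {E : ι → Type*}
    [∀ i, NormedAddCommGroup (E i)] [∀ i, InnerProductSpace ℂ (E i)] [∀ i, CompleteSpace (E i)]
    (J : ∀ i, E i →ₗᵢ[ℂ] K) (hJ : OrthogonalFamily ℂ E J)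
    (hd : (⨆ i, LinearMap.range (J i).toLinearMap).topologicalClosure = ⊤)
    (π : ∀ i, A →⋆ₐ[ℂ] (E i →L[ℂ] E i)) :
    ∃ σ : A →⋆ₐ[ℂ] (K →L[ℂ] K), ∀ a i x, σ a (J i x) = J i (π i a x) := by
  classical
  let e : (Π₀ i, E i) →ₗ[ℂ] K := DFinsupp.lsum ℂ fun i => (J i).toLinearMap
  have he1 i x : e (DFinsupp.single i x) = J i x := by
    simp [e]
  have he : DenseRange e := by
    rw [DenseRange, ← LinearMap.coe_range, Submodule.dense_iff_topologicalClosure_eq_top,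
      eq_top_iff, ← hd]
    refine Submodule.topologicalClosure_mono (iSup_le fun i => ?_)
    rintro _ ⟨x, rfl⟩
    exact ⟨_, he1 i x⟩
  let m (a : A) : (Π₀ i, E i) →ₗ[ℂ] (Π₀ i, E i) :=
    DFinsupp.mapRange.linearMap fun i => (π i a).toLinearMap
  have hm a x i : m a x i = π i a (x i) := rfl
  have hm1 a i x : m a (DFinsupp.single i x) = DFinsupp.single i (π i a x) := by
    simp [m, DFinsupp.mapRange.linearMap]
  -- On finitely supported families the action is purely algebraic; no uniform bound over the
  -- summands has to be supplied.
  obtain ⟨σ, hσ⟩ := exists_rep_of_dense e he m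
    (fun x => congrArg e (DFinsupp.ext fun i => by simp [hm]))
    (fun a b x => congrArg e (DFinsupp.ext fun i => by simp [hm]))
    (fun a b x => by
      rw [← map_add]; exact congrArg e (DFinsupp.ext fun i => by simp [hm]))
    (fun z a x => by
      rw [← map_smul]; exact congrArg e (DFinsupp.ext fun i => by simp [hm]))
    (fun a x y => by
      induction x using DFinsupp.induction with
      | h0 => simp
      | ha i u x _ _ hx =>
        rw [map_add, map_add, map_add, inner_add_left, inner_add_left, hx]
        congr 1
        clear hx
        induction y using DFinsupp.induction with
        | h0 => simp
        | ha j v y _ _ hy =>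
          rw [map_add, map_add, map_add, inner_add_right, inner_add_right, hy]
          congr 1
          rw [hm1, hm1, he1, he1, he1, he1]
          by_cases hij : i = j
          · subst hij
            rw [(J i).inner_map_map, (J i).inner_map_map, map_star,
              ContinuousLinearMap.star_eq_adjoint, ContinuousLinearMap.adjoint_inner_right]
          · rw [hJ hij, hJ hij])
  exact ⟨σ, fun a i x => by rw [← he1, hσ, hm1, he1]⟩

end HilbertTools

/-! ### Bundled representations and Hilbert sums. -/

/-- A representation of a `*`-algebra on a Hilbert space. -/
structure HilbertRep (R : Type uR) [Ring R] [StarRing R] [Algebra ℂ R] where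
  /-- The Hilbert space. -/
  space : Type uK
  [normed : NormedAddCommGroup space]
  [inner : InnerProductSpace ℂ space]
  [complete : CompleteSpace space]
  /-- The representation. -/
  hom : R →⋆ₐ[ℂ] (space →L[ℂ] space)

attribute [instance] HilbertRep.normed HilbertRep.inner HilbertRep.complete

theorem HilbertRep.inner_hom_left {R : Type uR} [Ring R] [StarRing R] [Algebra ℂ R]
    (P : HilbertRep.{uK} R) (a : R) (x y : P.space) :
    ⟪P.hom a x, y⟫_ℂ = ⟪x, P.hom (star a) y⟫_ℂ := by
  rw [map_star, ContinuousLinearMap.star_eq_adjoint, ContinuousLinearMap.adjoint_inner_right]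

theorem HilbertRep.hom_mul_apply {R : Type uR} [Ring R] [StarRing R] [Algebra ℂ R]
    (P : HilbertRep.{uK} R) (a b : R) (x : P.space) :
    P.hom (a * b) x = P.hom a (P.hom b x) := by
  rw [map_mul]; rfl

theorem HilbertRep.inner_hom_hom {R : Type uR} [Ring R] [StarRing R] [Algebra ℂ R]
    (P : HilbertRep.{uK} R) (a b : R) (x y : P.space) :
    ⟪P.hom a x, P.hom b y⟫_ℂ = ⟪x, P.hom (star a * b) y⟫_ℂ := by
  rw [P.inner_hom_left, P.hom_mul_apply]

/-- The Hilbert space direct sum of a family of Hilbert spaces. -/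
theorem exists_hilbert_sum {ι : Type uI} (E : ι → Type uK) [∀ i, NormedAddCommGroup (E i)]
    [∀ i, InnerProductSpace ℂ (E i)] [∀ i, CompleteSpace (E i)] :
    ∃ (K : Type (max uI uK)) (_ : NormedAddCommGroup K) (_ : InnerProductSpace ℂ K)
      (_ : CompleteSpace K) (J : ∀ i, E i →ₗᵢ[ℂ] K), OrthogonalFamily ℂ E J ∧
      (⨆ i, LinearMap.range (J i).toLinearMap).topologicalClosure = ⊤ := by
  classical
  let J (i : ι) : E i →ₗᵢ[ℂ] lp E 2 :=
    { toLinearMap := lp.lsingle 2 i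
      norm_map' := fun x => lp.norm_single (by norm_num) i x }
  have hJ i x : J i x = lp.single 2 i x := rfl
  refine ⟨lp E 2, inferInstance, inferInstance, inferInstance, J, ?_, ?_⟩
  · intro i j hij x y
    rw [hJ, hJ, lp.inner_single_left, lp.single_apply_ne _ _ _ hij, inner_zero_right]
  · rw [Submodule.topologicalClosure_eq_top_iff, eq_bot_iff]
    intro f hf
    rw [Submodule.mem_bot]
    ext i : 2
    refine ext_inner_left ℂ fun x => ?_
    rw [← lp.inner_single_left, lp.coeFn_zero, Pi.zero_apply, inner_zero_right]
    have hx : lp.single 2 i x ∈ ⨆ i, LinearMap.range (J i).toLinearMap :=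
      Submodule.mem_iSup_of_mem i (LinearMap.mem_range_self (J i).toLinearMap x)
    exact Submodule.inner_right_of_mem_orthogonal hx hf

/-! ### Extending representations from `B` to `A`. -/

section Extension

variable {B : Type uB} [CStarAlgebra B] {A : Type uA} [CStarAlgebra A]

/-- An injective `*`-homomorphism preserves the spectrum of a self-adjoint element, and the spectrum
decides positivity. Thus a positive functional on `B` is positive on the copy of `B` inside `A`. -/
theorem nonneg_of_map_nonneg [PartialOrder A] [StarOrderedRing A] [PartialOrder B]
    [StarOrderedRing B] (ε : B →⋆ₐ[ℂ] A) (hε : Function.Injective ε) {b : B}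
    (hb : IsSelfAdjoint b) (h : 0 ≤ ε b) : 0 ≤ b := by
  rw [StarOrderedRing.nonneg_iff_spectrum_nonneg (R := ℝ) b]
  rw [StarOrderedRing.nonneg_iff_spectrum_nonneg (R := ℝ) (ε b) (h.isSelfAdjoint),
    hb.map_spectrum_real ε hε] at h
  exact h

/-- A positive functional on a unital C*-subalgebra extends to a positive functional. -/
theorem exists_positive_extension [PartialOrder A] [StarOrderedRing A] [PartialOrder B]
    [StarOrderedRing B] (ε : B →⋆ₐ[ℂ] A) (hε : Function.Injective ε) (f : B →ₚ[ℂ] ℂ) :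
    ∃ g : A →ₚ[ℂ] ℂ, ∀ b, g (ε b) = f b := by
  -- The M. Riesz extension theorem is applied to the real part of `f` on all of `A` as a real
  -- space. The cone contains every skew-adjoint element together with its negative, which forces
  -- the extension to vanish on them.
  let s : PointedCone ℝ A :=
    { carrier := {x | 0 ≤ x + star x}
      add_mem' := fun {x y} hx hy => by
        change 0 ≤ x + y + star (x + y)
        rw [star_add, add_add_add_comm]
        exact add_nonneg hx hy
      zero_mem' := by simp
      smul_mem' := fun c x hx => by
        change 0 ≤ (c : ℝ) • x + star ((c : ℝ) • x)
        rw [star_smul, star_trivial, ← smul_add]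
        exact smul_nonneg c.2 hx }
  have hs x : x ∈ s ↔ 0 ≤ x + star x := Iff.rfl
  let εR : B →ₗ[ℝ] A := ε.toLinearMap.restrictScalars ℝ
  let fR : B →ₗ[ℝ] ℝ := Complex.reLm ∘ₗ (f.toLinearMap.restrictScalars ℝ)
  let e := LinearEquiv.ofInjective εR hε
  let F : A →ₗ.[ℝ] ℝ := ⟨LinearMap.range εR, fR ∘ₗ e.symm.toLinearMap⟩
  have hF b : F ⟨ε b, b, rfl⟩ = (f b).re := by
    change fR (e.symm ⟨ε b, b, rfl⟩) = _
    have : e.symm ⟨ε b, b, rfl⟩ = b := e.symm_apply_apply b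
    rw [this]
    rfl
  obtain ⟨g, hg, hgs⟩ := riesz_extension s F
    (by
      rintro ⟨_, b, rfl⟩ hx
      rw [hs] at hx
      change 0 ≤ ε b + star (ε b) at hx
      rw [← map_star, ← map_add] at hx
      have h := f.map_nonneg (nonneg_of_map_nonneg ε hε (IsSelfAdjoint.add_star_self b) hx)
      rw [map_add, map_star, Complex.nonneg_iff] at h
      have h1 := h.1
      simp only [Complex.add_re, Complex.star_def, Complex.conj_re] at h1
      refine (hF b).symm ▸ ?_
      linarith)
    (fun y => by
      -- Cofinality: `B` contains the scalars, and the scalar `‖y + y*‖` already dominates `-(y +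
      -- y*)`.
      refine ⟨⟨ε (algebraMap ℝ B ‖y + star y‖), _, rfl⟩, ?_⟩
      have h := IsSelfAdjoint.neg_algebraMap_norm_le_self (IsSelfAdjoint.add_star_self y)
      have h1 : ε (algebraMap ℝ B ‖y + star y‖) = algebraMap ℝ A ‖y + star y‖ := by
        simp only [Algebra.algebraMap_eq_smul_one]
        rw [← Complex.coe_smul, map_smul, map_one, Complex.coe_smul]
      have h2 : (0 : A) ≤ algebraMap ℝ A ‖y + star y‖ := by
        rw [Algebra.algebraMap_eq_smul_one]
        exact smul_nonneg (norm_nonneg _) zero_le_one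
      rw [hs]
      change 0 ≤ ε (algebraMap ℝ B ‖y + star y‖) + y + star (ε (algebraMap ℝ B ‖y + star y‖) + y)
      rw [h1, star_add, h2.isSelfAdjoint.star_eq, add_add_add_comm, add_assoc]
      exact add_nonneg h2 (by rwa [neg_le_iff_add_nonneg'] at h))
  have hgi a (ha : 0 ≤ a) : g (Complex.I • a) = 0 := by
    have h0 : Complex.I • a + star (Complex.I • a) = 0 := by
      rw [star_smul, ha.isSelfAdjoint.star_eq]; simp
    have h1 : 0 ≤ g (Complex.I • a) := hgs _ (by rw [hs, h0])
    have h2 : 0 ≤ g (-(Complex.I • a)) := hgs _ (by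
      rw [hs, star_neg, ← neg_add, h0, neg_zero])
    rw [map_neg] at h2
    linarith
  -- The complex functional is `x ↦ g x - i g (i x)`; its imaginary part vanishes on positive `a` by
  -- `hgi`.
  refine ⟨PositiveLinearMap.mk₀ (Module.Dual.extendRCLike (𝕜 := ℂ) g) fun a ha => ?_, fun b => ?_⟩
  · rw [Module.Dual.extendRCLike_apply]
    have h := hgi a ha
    have h' : 0 ≤ g a := hgs _ (by
      rw [hs, ha.isSelfAdjoint.star_eq]; exact add_nonneg ha ha)
    simp [h, h']
  · change Module.Dual.extendRCLike (𝕜 := ℂ) g (ε b) = _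
    rw [Module.Dual.extendRCLike_apply]
    have h1 : g (ε b) = (f b).re := (hg ⟨ε b, b, rfl⟩).trans (hF b)
    have h2 : g (Complex.I • ε b) = (f (Complex.I • b)).re := by
      rw [← map_smul]; exact (hg ⟨ε (Complex.I • b), _, rfl⟩).trans (hF _)
    have h3 : (RCLike.I : ℂ) = Complex.I := rfl
    rw [h3, h1, h2]
    apply Complex.ext <;> simp

/-- The Gelfand-Naimark-Segal construction. -/
theorem exists_gns [PartialOrder A] [StarOrderedRing A] (g : A →ₚ[ℂ] ℂ) :
    ∃ (P : HilbertRep.{uA} A) (Ω : P.space), ∀ a, ⟪Ω, P.hom a Ω⟫_ℂ = g a := by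
  refine ⟨⟨g.GNS, g.gnsStarAlgHom⟩, (g.toPreGNS 1 : g.PreGNS), fun a => ?_⟩
  change ⟪((g.toPreGNS 1 : g.PreGNS) : g.GNS),
    g.gnsNonUnitalStarAlgHom a ((g.toPreGNS 1 : g.PreGNS) : g.GNS)⟫_ℂ = _
  rw [PositiveLinearMap.gnsNonUnitalStarAlgHom_apply_coe,
    UniformSpace.Completion.inner_coe, PositiveLinearMap.preGNS_inner_def]
  simp

/-- The vector functional of `ξ` is positive, so it extends to `A` and has a GNS vector `Ω`.
Equality of the functionals on `B` makes the cyclic `B`-subspaces of `ξ` and `Ω` isometric. -/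
theorem exists_extension_vectorState (ε : B →⋆ₐ[ℂ] A) (hε : Function.Injective ε)
    (Y : HilbertRep.{uK} B) (ξ : Y.space) :
    ∃ (P : HilbertRep.{uA} A) (Ω : P.space), ∀ b, ⟪Ω, P.hom (ε b) Ω⟫_ℂ = ⟪ξ, Y.hom b ξ⟫_ℂ := by
  let _ := CStarAlgebra.spectralOrder A
  have := CStarAlgebra.spectralOrderedRing A
  let _ := CStarAlgebra.spectralOrder B
  have := CStarAlgebra.spectralOrderedRing B
  let f : B →ₚ[ℂ] ℂ := PositiveLinearMap.mk₀
    { toFun := fun b => ⟪ξ, Y.hom b ξ⟫_ℂ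
      map_add' := fun b c => by simp
      map_smul' := fun z b => by simp } fun b hb => by
    obtain ⟨c, rfl⟩ := CStarAlgebra.nonneg_iff_eq_star_mul_self.mp hb
    change 0 ≤ ⟪ξ, Y.hom (star c * c) ξ⟫_ℂ
    rw [← Y.inner_hom_hom]
    rw [inner_self_eq_norm_sq_to_K]
    exact mod_cast (RCLike.ofReal_nonneg (K := ℂ)).mpr (sq_nonneg ‖Y.hom c ξ‖)
  obtain ⟨g, hg⟩ := exists_positive_extension ε hε f
  obtain ⟨P, Ω, h⟩ := exists_gns g
  exact ⟨P, Ω, fun b => (h _).trans (hg b)⟩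

/-- Every representation is a direct sum of cyclic ones. -/
theorem exists_orthogonal_cyclic (Y : HilbertRep.{uK} B) :
    ∃ S : Set Y.space, S.Pairwise (fun ξ η => ∀ b, ⟪ξ, Y.hom b η⟫_ℂ = 0) ∧
      (Submodule.span ℂ (Set.range fun p : B × S => Y.hom p.1 (p.2 : Y.space))).topologicalClosure
        = ⊤ := by
  let r : Y.space → Y.space → Prop := fun ξ η => ∀ b, ⟪ξ, Y.hom b η⟫_ℂ = 0
  obtain ⟨S, hS⟩ := zorn_subset {S : Set Y.space | S.Pairwise r} (by
    intro c hc hch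
    refine ⟨⋃₀ c, ?_, fun s hs => Set.subset_sUnion_of_mem hs⟩
    exact (Set.pairwise_sUnion hch.directedOn).mpr fun s hs => hc hs)
  refine ⟨S, hS.prop, ?_⟩
  rw [Submodule.topologicalClosure_eq_top_iff, eq_bot_iff]
  intro η hη
  have hη' (ξ) (hξ : ξ ∈ S) b : ⟪Y.hom b ξ, η⟫_ℂ = 0 := by
    refine Submodule.inner_right_of_mem_orthogonal (Submodule.subset_span ?_) hη
    exact ⟨(b, ⟨ξ, hξ⟩), rfl⟩
  -- A vector orthogonal to all cyclic subspaces can be adjoined to `S`, so by maximality it lies in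
  -- `S` already; it is then orthogonal to its own cyclic subspace and vanishes.
  have hmem : η ∈ S := by
    refine hS.le_of_ge (y := insert η S) ?_ (Set.subset_insert _ _) (Set.mem_insert _ _)
    refine Set.Pairwise.insert hS.prop fun ξ hξ _ => ⟨fun b => ?_, fun b => ?_⟩
    · rw [← inner_conj_symm, hη' ξ hξ, map_zero]
    · rw [← star_star b, ← Y.inner_hom_left, hη' ξ hξ]
  have h := hη' η hmem 1
  rw [map_one] at h
  exact inner_self_eq_zero.mp h

/-- Every representation of a unital C*-subalgebra is contained in the restriction of a
representation of the whole algebra. -/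
theorem exists_extension_rep (ε : B →⋆ₐ[ℂ] A) (hε : Function.Injective ε)
    (Y : HilbertRep.{uK} B) :
    ∃ (P : HilbertRep.{max uA uK} A) (V : Y.space →ₗᵢ[ℂ] P.space),
      ∀ b y, V (Y.hom b y) = P.hom (ε b) (V y) := by
  obtain ⟨S, hS, hd⟩ := exists_orthogonal_cyclic Y
  choose G Ω hΩ using fun ξ : S => exists_extension_vectorState ε hε Y ξ
  obtain ⟨K, _, _, _, J, hJ, hJd⟩ := exists_hilbert_sum fun ξ : S => (G ξ).space
  obtain ⟨π, hπ⟩ := exists_rep_directSum J hJ hJd fun ξ => (G ξ).hom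
  -- Send the cyclic subspace of each `ξ` to that of its GNS vector: the Gram matrices agree within
  -- a summand by `hΩ` and vanish across distinct ones.
  obtain ⟨V, hV⟩ := exists_isometry_of_inner_eq
    (fun p : B × S => Y.hom p.1 (p.2 : Y.space))
    (fun p : B × S => J p.2 ((G p.2).hom (ε p.1) (Ω p.2))) hd (by
      rintro ⟨b, ξ⟩ ⟨c, η⟩
      change ⟪Y.hom b (ξ : Y.space), Y.hom c (η : Y.space)⟫_ℂ =
        ⟪J ξ ((G ξ).hom (ε b) (Ω ξ)), J η ((G η).hom (ε c) (Ω η))⟫_ℂ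
      rw [Y.inner_hom_hom]
      by_cases h : ξ = η
      · subst h
        rw [(J ξ).inner_map_map, (G ξ).inner_hom_hom, ← map_star, ← map_mul, hΩ]
      · rw [hJ h, hS ξ.2 η.2 (fun h' => h (Subtype.ext h'))])
  refine ⟨⟨K, π⟩, V, fun b y => ?_⟩
  have key : V.toContinuousLinearMap ∘L Y.hom b = π (ε b) ∘L V.toContinuousLinearMap := by
    refine ContinuousLinearMap.ext_on (Submodule.dense_iff_topologicalClosure_eq_top.mpr hd) ?_
    rintro _ ⟨⟨c, ξ⟩, rfl⟩
    change V (Y.hom b (Y.hom c (ξ : Y.space))) = π (ε b) (V (Y.hom c (ξ : Y.space)))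
    have h1 := hV (b * c, ξ)
    have h2 := hV (c, ξ)
    simp only at h1 h2
    rw [← Y.hom_mul_apply, h1, h2, hπ, map_mul, (G ξ).hom_mul_apply]
  exact DFunLike.congr_fun key y

end Extension

/-! ### A positivity criterion in C*-algebras. -/

section AbstractPositivity

variable {C : Type*} [CStarAlgebra C] [PartialOrder C] [StarOrderedRing C]

theorem exists_eq_star_mul_self {x : C} (h : 0 ≤ x) : ∃ y : C, x = star y * y :=
  CStarAlgebra.nonneg_iff_eq_star_mul_self.mp h

/-- Conjugating `x` by its negative part `y` isolates `-y³`. If `y = c* c`, this is `-(c y)* (c y)`,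
so the hypothesis gives `c y = 0`, whence `y² = 0` and `y = 0`. For operator matrices the hypothesis
can be tested on vectors. -/
theorem nonneg_of_conjugate {x : C} (hx : IsSelfAdjoint x)
    (h : ∀ y c : C, star y * x * y = -(star c * c) → c = 0) : 0 ≤ x := by
  have hdec := CFC.posPart_sub_negPart x hx
  have hnn := CFC.negPart_nonneg x
  have hmul := CFC.negPart_mul_posPart x
  set y := x⁻
  have hsa : star y = y := hnn.isSelfAdjoint.star_eq
  obtain ⟨c, hc⟩ := CStarAlgebra.nonneg_iff_eq_star_mul_self.mp hnn
  have hz : c * y = 0 := by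
    refine h y (c * y) ?_
    rw [star_mul, mul_assoc (star y) (star c), ← mul_assoc (star c), ← hc, ← hdec, mul_sub, hsa,
      hmul, zero_sub, neg_mul, mul_assoc]
  have hy : y = 0 := by
    refine (CStarRing.star_mul_self_eq_zero_iff y).mp ?_
    rw [hsa]
    nth_rewrite 1 [hc]
    rw [mul_assoc, hz, mul_zero]
  rw [← hdec, hy, sub_zero]
  exact CFC.posPart_nonneg x

end AbstractPositivity

/-! ### Positivity of operator matrices through their quadratic forms. -/

section MatrixPositivity

variable {n : Type*} [Fintype n] {H : Type uH} [NormedAddCommGroup H] [InnerProductSpace ℂ H]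

/-- The action of a matrix of operators on a tuple of vectors. -/
noncomputable def opMulVec (M : CStarMatrix n n (H →L[ℂ] H)) (v : n → H) (i : n) : H :=
  ∑ j, M i j (v j)

theorem opMulVec_mul (M N : CStarMatrix n n (H →L[ℂ] H)) (v : n → H) :
    opMulVec (M * N) v = opMulVec M (opMulVec N v) := by
  funext i
  simp only [opMulVec, CStarMatrix.mul_apply, sum_apply, map_sum]
  exact Finset.sum_comm

theorem opMulVec_neg (M : CStarMatrix n n (H →L[ℂ] H)) (v : n → H) :
    opMulVec (-M) v = -opMulVec M v := by
  funext i
  simp [opMulVec]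

theorem eq_zero_of_opMulVec [DecidableEq n] {M : CStarMatrix n n (H →L[ℂ] H)}
    (h : ∀ v i, opMulVec M v i = 0) : M = 0 := by
  ext i j x
  have := h (Pi.single j x) i
  rw [opMulVec, Finset.sum_eq_single j (fun k _ hk => by simp [hk]) (by simp)] at this
  simpa using this

variable [CompleteSpace H]

theorem inner_opMulVec_star (M : CStarMatrix n n (H →L[ℂ] H)) (v w : n → H) :
    ∑ i, ⟪v i, opMulVec (star M) w i⟫_ℂ = ∑ i, ⟪opMulVec M v i, w i⟫_ℂ := by
  simp only [opMulVec, inner_sum, sum_inner]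
  rw [Finset.sum_comm]
  refine Finset.sum_congr rfl fun i _ => Finset.sum_congr rfl fun j _ => ?_
  rw [CStarMatrix.star_apply, ContinuousLinearMap.star_eq_adjoint,
    ContinuousLinearMap.adjoint_inner_right]

theorem inner_opMulVec_star_mul_self (M : CStarMatrix n n (H →L[ℂ] H)) (v : n → H) :
    (∑ i, ⟪v i, opMulVec (star M * M) v i⟫_ℂ).re = ∑ i, ‖opMulVec M v i‖ ^ 2 := by
  rw [opMulVec_mul, inner_opMulVec_star, Complex.re_sum]
  exact Finset.sum_congr rfl fun i _ => inner_self_eq_norm_sq (𝕜 := ℂ) _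

variable [DecidableEq n]

theorem re_inner_opMulVec_nonneg {M : CStarMatrix n n (H →L[ℂ] H)} (hM : 0 ≤ M) (v : n → H) :
    0 ≤ (∑ i, ⟪v i, opMulVec M v i⟫_ℂ).re := by
  obtain ⟨N, rfl⟩ := exists_eq_star_mul_self hM
  rw [inner_opMulVec_star_mul_self]
  exact Finset.sum_nonneg fun i _ => sq_nonneg _

/-- A self-adjoint matrix of operators with positive quadratic form is positive. -/
theorem nonneg_of_re_inner_opMulVec {M : CStarMatrix n n (H →L[ℂ] H)} (hM : IsSelfAdjoint M)
    (h : ∀ v : n → H, 0 ≤ (∑ i, ⟪v i, opMulVec M v i⟫_ℂ).re) : 0 ≤ M := by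
  refine nonneg_of_conjugate hM fun N C hC => eq_zero_of_opMulVec fun v i => ?_
  have h1 := h (opMulVec N v)
  rw [← inner_opMulVec_star, ← opMulVec_mul, ← opMulVec_mul, hC, opMulVec_neg] at h1
  simp only [Pi.neg_apply, inner_neg_right, Finset.sum_neg_distrib, Complex.neg_re] at h1
  rw [inner_opMulVec_star_mul_self, Left.nonneg_neg_iff] at h1
  have h2 := (Finset.sum_eq_zero_iff_of_nonneg fun i _ => sq_nonneg _).mp
    (le_antisymm h1 (Finset.sum_nonneg fun i _ => sq_nonneg _)) i (Finset.mem_univ i)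
  simpa using h2

/-- The matrix is `R* R`, where `R` has the tuple `a` as its row `k` and zeros elsewhere. An empty
index set offers no `k` and is treated apart. -/
theorem star_mul_matrix_nonneg {A : Type*} [CStarAlgebra A] [PartialOrder A] [StarOrderedRing A]
    (a : n → A) : 0 ≤ (CStarMatrix.ofMatrix fun i j => star (a i) * a j : CStarMatrix n n A) := by
  rcases isEmpty_or_nonempty n with hn | ⟨⟨k⟩⟩
  · exact (show _ = _ by ext i; exact hn.elim i : (0 : CStarMatrix n n A) = _).le
  · have h : (CStarMatrix.ofMatrix fun i j => star (a i) * a j : CStarMatrix n n A) =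
        star (CStarMatrix.ofMatrix fun i j => if i = k then a j else 0 : CStarMatrix n n A) *
          (CStarMatrix.ofMatrix fun i j => if i = k then a j else 0 : CStarMatrix n n A) := by
      ext i j
      rw [CStarMatrix.mul_apply, Finset.sum_eq_single k]
      · change star (a i) * a j = star (if k = k then a i else 0) * (if k = k then a j else 0)
        rw [if_pos rfl, if_pos rfl]
      · intro l _ hl
        change star (if l = k then a i else 0) * (if l = k then a j else 0) = 0
        rw [if_neg hl, if_neg hl, mul_zero]
      · simp
    rw [h]
    exact star_mul_self_nonneg _

end MatrixPositivity

/-! ### Stinespring dilation. -/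

section Stinespring

variable {A : Type uA} [CStarAlgebra A] [PartialOrder A] [StarOrderedRing A]
  {H : Type uH} [NormedAddCommGroup H] [InnerProductSpace ℂ H] [CompleteSpace H]

/-- This is complete positivity applied to the matrix of products `x* y`, with `x` and `y` in the
support of `f`. -/
theorem kernel_nonneg (Φ : A →CP (H →L[ℂ] H)) (f : A →₀ H) :
    0 ≤ (f.sum fun x v => f.sum fun y w => ⟪Φ (star y * x) v, w⟫_ℂ).re := by
  classical
  let n := f.support
  have h := Φ.map_cstarMatrix_nonneg _ (star_mul_matrix_nonneg fun i : n => (i : A))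
  have h1 := re_inner_opMulVec_nonneg h fun i => f i
  -- Conjugation swaps the two sides of the inner product without changing the real part.
  rw [← Complex.conj_re] at h1
  convert h1 using 1
  simp only [Finsupp.sum, opMulVec, inner_sum, map_sum, inner_conj_symm, Complex.re_sum]
  rw [Finset.sum_comm, ← Finset.sum_coe_sort]
  refine Finset.sum_congr rfl fun x _ => ?_
  rw [← Finset.sum_coe_sort]
  rfl

/-- The Stinespring dilation of a unital completely positive map. -/
theorem exists_stinespring (Φ : A →CP (H →L[ℂ] H)) (hΦ : Φ 1 = 1) :
    ∃ (P : HilbertRep.{max uA uH} A) (V : H →ₗᵢ[ℂ] P.space),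
      ∀ a h h', ⟪V h, P.hom a (V h')⟫_ℂ = ⟪h, Φ a h'⟫_ℂ := by
  -- Here `j a v` plays the role of the elementary tensor `a ⊗ v`. Its linearity in `a` is not part
  -- of the construction and is recovered by testing against the total family.
  obtain ⟨S, _, _, _, j, hj, hd⟩ := exists_space_of_kernel (fun a b : A => Φ (star a * b))
    (fun a b => by rw [← map_star, star_mul, star_star]) (kernel_nonneg Φ)
  have hext {x x' : S} (h : ∀ c v, ⟪x, j c v⟫_ℂ = ⟪x', j c v⟫_ℂ) : x = x' := by
    refine ext_inner_right ℂ fun y => ?_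
    refine DFunLike.congr_fun (ContinuousLinearMap.ext_on (f := innerSL ℂ x) (g := innerSL ℂ x')
      (Submodule.dense_iff_topologicalClosure_eq_top.mpr hd) ?_) y
    rintro _ ⟨⟨c, v⟩, rfl⟩
    exact h c v
  have hjadd a b v : j (a + b) v = j a v + j b v := hext fun c w => by
    rw [inner_add_left, hj, hj, hj, star_add, add_mul, map_add,
      add_apply, inner_add_right]
  have hjsmul (z : ℂ) a v : j (z • a) v = z • j a v := hext fun c w => by
    rw [inner_smul_left, hj, hj, star_smul, smul_mul_assoc, map_smul,
      smul_apply, inner_smul_right]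
    rfl
  let e := Finsupp.linearCombination ℂ fun p : A × H => j p.1 p.2
  -- Left multiplication on the first tensor factor, defined on formal combinations so that no
  -- well-definedness has to be checked.
  let m (a : A) : (A × H →₀ ℂ) →ₗ[ℂ] (A × H →₀ ℂ) :=
    Finsupp.lmapDomain ℂ ℂ fun p => (a * p.1, p.2)
  have he p z : e (Finsupp.single p z) = z • j p.1 p.2 := Finsupp.linearCombination_single _ _ _
  have hm a p z : m a (Finsupp.single p z) = Finsupp.single (a * p.1, p.2) z :=
    Finsupp.mapDomain_single
  obtain ⟨π, hπ⟩ := exists_rep_of_dense e (denseRange_linearCombination hd) m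
    (fun x => by
      congr 1
      induction x using Finsupp.induction_linear with
      | zero => simp
      | add f g hf hg => rw [map_add, hf, hg]
      | single p z => rw [hm, one_mul])
    (fun a b x => by
      congr 1
      induction x using Finsupp.induction_linear with
      | zero => simp
      | add f g hf hg => simp only [map_add, hf, hg]
      | single p z => rw [hm, hm, hm, mul_assoc])
    (fun a b x => by
      induction x using Finsupp.induction_linear with
      | zero => simp
      | add f g hf hg => simp only [map_add, hf, hg]; abel
      | single p z => rw [hm, hm, hm, he, he, he, add_mul, hjadd, smul_add])
    (fun z a x => by
      induction x using Finsupp.induction_linear with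
      | zero => simp
      | add f g hf hg => simp only [map_add, hf, hg, smul_add]
      | single p w => rw [hm, hm, he, he, smul_mul_assoc, hjsmul, smul_comm])
    (fun a x y => by
      induction x using Finsupp.induction_linear with
      | zero => simp
      | add f g hf hg => simp only [map_add, inner_add_left, hf, hg]
      | single p z =>
        induction y using Finsupp.induction_linear with
        | zero => simp
        | add f g hf hg => simp only [map_add, inner_add_right, hf, hg]
        | single q w =>
          simp only [hm, he, inner_smul_left, inner_smul_right, hj, star_mul, mul_assoc])
  have hπj a c v : π a (j c v) = j (a * c) v := by
    have h := hπ a (Finsupp.single (c, v) 1)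
    rwa [hm, he, he, one_smul, one_smul] at h
  have hnorm v : ‖j 1 v‖ = ‖v‖ := by
    rw [← sq_eq_sq₀ (norm_nonneg _) (norm_nonneg _), ← inner_self_eq_norm_sq (𝕜 := ℂ),
      ← inner_self_eq_norm_sq (𝕜 := ℂ), hj, star_one, one_mul, hΦ]
    rfl
  let V : H →ₗᵢ[ℂ] S := ⟨(j 1).toLinearMap, hnorm⟩
  have hV a v w : ⟪V v, π a (V w)⟫_ℂ = ⟪v, Φ a w⟫_ℂ := by
    change ⟪j 1 v, π a (j 1 w)⟫_ℂ = _
    rw [hπj, hj, star_one, one_mul, mul_one]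
  exact ⟨⟨S, π⟩, V, hV⟩

/-- A dilation of a map that is multiplicative on `B` intertwines the representations of `B`. -/
theorem dilation_equivariant {A : Type uA} [CStarAlgebra A] {B : Type uB} [CStarAlgebra B]
    (ε : B →⋆ₐ[ℂ] A)
    (Φ : A → (H →L[ℂ] H)) (ρ : B →⋆ₐ[ℂ] (H →L[ℂ] H)) (hρ : ∀ b, Φ (ε b) = ρ b)
    (P : HilbertRep.{uK} A) (V : H →ₗᵢ[ℂ] P.space)
    (hV : ∀ a h h', ⟪V h, P.hom a (V h')⟫_ℂ = ⟪h, Φ a h'⟫_ℂ) (b : B) (h : H) :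
    V (ρ b h) = P.hom (ε b) (V h) := by
  have h1 h' : ⟪V h', P.hom (ε b) (V h)⟫_ℂ = ⟪h', ρ b h⟫_ℂ := by rw [hV, hρ]
  -- Multiplicativity on `B` enters here, through `Φ (ε (b* b)) = ρ (b* b)`. All four terms of the
  -- squared norm of the difference then coincide up to sign and cancel.
  have h2 : ⟪P.hom (ε b) (V h), P.hom (ε b) (V h)⟫_ℂ = ⟪ρ b h, ρ b h⟫_ℂ := by
    rw [P.inner_hom_hom, ← map_star, ← map_mul, hV, hρ]
    exact ((⟨H, ρ⟩ : HilbertRep B).inner_hom_hom b b h h).symm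
  have h3 : ⟪P.hom (ε b) (V h), V (ρ b h)⟫_ℂ = ⟪ρ b h, ρ b h⟫_ℂ := by
    rw [← inner_conj_symm, h1, inner_conj_symm]
  rw [← sub_eq_zero, ← inner_self_eq_zero (𝕜 := ℂ), inner_sub_left, inner_sub_right,
    inner_sub_right, h2, h1, h3, V.inner_map_map, sub_self]

end Stinespring

/-! ### Dilations of representations of `B` and their complements. -/

section Dilation

variable {B : Type uB} [CStarAlgebra B] {A : Type uA} [CStarAlgebra A]

/-- A representation of `A` whose restriction to `B` contains a given representation of `B`
as a direct summand. -/
structure Dilation (ε : B →⋆ₐ[ℂ] A) (Y : HilbertRep.{uK} B) where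
  /-- The representation of `A`. -/
  rep : HilbertRep.{uK} A
  /-- The inclusion of the given representation. -/
  embed : Y.space →ₗᵢ[ℂ] rep.space
  /-- The complementary representation of `B`. -/
  compl : HilbertRep.{uK} B
  /-- The inclusion of the complement. -/
  complEmbed : compl.space →ₗᵢ[ℂ] rep.space
  inner_eq_zero : ∀ y c, ⟪embed y, complEmbed c⟫_ℂ = 0
  exists_add : ∀ x, ∃ y c, x = embed y + complEmbed c
  map_embed : ∀ b y, rep.hom (ε b) (embed y) = embed (Y.hom b y)
  map_complEmbed : ∀ b c, rep.hom (ε b) (complEmbed c) = complEmbed (compl.hom b c)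

/-- The range of an intertwining isometry is closed and `B`-invariant; as `B` is closed under the
involution, its orthogonal complement is invariant too. The dilation lives on `P` itself, and `U` is
the identity. -/
theorem exists_dilation (ε : B →⋆ₐ[ℂ] A) (Y : HilbertRep.{uK} B) (P : HilbertRep.{uK} A)
    (V : Y.space →ₗᵢ[ℂ] P.space) (hV : ∀ b y, V (Y.hom b y) = P.hom (ε b) (V y)) :
    ∃ D : Dilation ε Y, ∃ U : P.space →ₗᵢ[ℂ] D.rep.space,
      (∀ y, D.embed y = U (V y)) ∧ ∀ a x, U (P.hom a x) = D.rep.hom a (U x) := by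
  let S : Submodule ℂ P.space := LinearMap.range V.toLinearMap
  have hS : IsClosed (S : Set P.space) := by
    have h := V.isometry.isClosedEmbedding.isClosed_range
    exact h
  have : CompleteSpace S := hS.completeSpace_coe
  have hmem y : V y ∈ S := ⟨y, rfl⟩
  obtain ⟨σ, hσ⟩ := exists_rep_restrict (P.hom.comp ε) Sᗮ.subtypeₗᵢ fun b c => by
    refine ⟨⟨P.hom (ε b) c, ?_⟩, rfl⟩
    rintro _ ⟨y, rfl⟩
    change ⟪V y, P.hom (ε b) c⟫_ℂ = 0
    rw [← star_star (ε b), ← P.inner_hom_left, ← map_star, ← hV]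
    exact c.2 _ (hmem _)
  refine ⟨⟨P, V, ⟨Sᗮ, σ⟩, Sᗮ.subtypeₗᵢ, fun y c => c.2 _ (hmem y), fun x => ?_,
    fun b y => (hV b y).symm, fun b c => (hσ b c).symm⟩, LinearIsometry.id,
    fun y => rfl, fun a x => rfl⟩
  obtain ⟨y, hy, z, hz, h⟩ := S.exists_add_mem_mem_orthogonal x
  obtain ⟨y, rfl⟩ := hy
  exact ⟨y, ⟨z, hz⟩, h⟩

/-- The dilation space is the orthogonal sum of its two parts, so orthogonal placements of the parts
combine. This identifies it with a sum of two word summands in the glued space. -/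
theorem Dilation.exists_isometry {ε : B →⋆ₐ[ℂ] A} {Y : HilbertRep.{uK} B} (D : Dilation ε Y)
    {K : Type*} [NormedAddCommGroup K] [InnerProductSpace ℂ K] [CompleteSpace K]
    (s : Y.space →ₗᵢ[ℂ] K) (t : D.compl.space →ₗᵢ[ℂ] K) (h : ∀ y c, ⟪s y, t c⟫_ℂ = 0) :
    ∃ J : D.rep.space →ₗᵢ[ℂ] K, (∀ y, J (D.embed y) = s y) ∧ ∀ c, J (D.complEmbed c) = t c := by
  obtain ⟨J, hJ⟩ := exists_isometry_of_inner_eq (Sum.elim D.embed D.complEmbed) (Sum.elim s t)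
    (by
      rw [eq_top_iff]
      intro x _
      obtain ⟨y, c, rfl⟩ := D.exists_add x
      exact Submodule.le_topologicalClosure _ (add_mem (Submodule.subset_span ⟨.inl y, rfl⟩)
        (Submodule.subset_span ⟨.inr c, rfl⟩)))
    (by
      rintro (y | c) (y' | c') <;> simp only [Sum.elim_inl, Sum.elim_inr]
      · rw [D.embed.inner_map_map, s.inner_map_map]
      · rw [D.inner_eq_zero, h]
      · rw [← inner_conj_symm, D.inner_eq_zero, ← inner_conj_symm, h]
      · rw [D.complEmbed.inner_map_map, t.inner_map_map])
  exact ⟨J, fun y => hJ (.inl y), fun c => hJ (.inr c)⟩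

end Dilation

/-! ### Gluing along reduced words. -/

section Glue

variable {I : Type uI} {B : Type uB} [CStarAlgebra B] {A : I → Type uA}
  [∀ i, CStarAlgebra (A i)] {ε : ∀ i, B →⋆ₐ[ℂ] A i}

/-- The representations of `B` indexed by words that make up the free product space: a letter `i`
is prepended by passing to the complement in the dilation to `A i`. -/
noncomputable def wordRep (Y : HilbertRep.{uK} B)
    (F : ∀ i (Y : HilbertRep.{uK} B), Dilation (ε i) Y) : List I → HilbertRep.{uK} B
  | [] => Y
  | i :: w => (F i (wordRep Y F w)).compl

theorem ext_of_iSup_range {ι : Type*} {E : ι → Type*} [∀ i, NormedAddCommGroup (E i)]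
    [∀ i, InnerProductSpace ℂ (E i)] {K : Type*} [NormedAddCommGroup K] [InnerProductSpace ℂ K]
    {J : ∀ i, E i →ₗᵢ[ℂ] K}
    (hd : (⨆ i, LinearMap.range (J i).toLinearMap).topologicalClosure = ⊤) {S T : K →L[ℂ] K}
    (h : ∀ i x, S (J i x) = T (J i x)) : S = T := by
  refine ContinuousLinearMap.coeFn_injective (Continuous.ext_on
    (Submodule.dense_iff_topologicalClosure_eq_top.mpr hd) S.continuous T.continuous ?_)
  have hle : (⨆ i, LinearMap.range (J i).toLinearMap) ≤
      LinearMap.eqLocus S.toLinearMap T.toLinearMap :=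
    iSup_le fun i => by
      rintro _ ⟨x, rfl⟩
      exact h i x
  exact fun x hx => hle hx

/-- Dilations of representations of `B` to representations of the `A i` can be glued to
representations of all the `A i` on the same space that agree on `B`. -/
theorem exists_glued_reps (Y : HilbertRep.{uK} B)
    (F : ∀ i (Y : HilbertRep.{uK} B), Dilation (ε i) Y) :
    ∃ (K : HilbertRep.{max uI uK} B) (π : ∀ i, A i →⋆ₐ[ℂ] (K.space →L[ℂ] K.space))
      (s : Y.space →ₗᵢ[ℂ] K.space) (J : ∀ i, (F i Y).rep.space →ₗᵢ[ℂ] K.space),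
      (∀ i b, π i (ε i b) = K.hom b) ∧ (∀ i y, J i ((F i Y).embed y) = s y) ∧
      ∀ i a x, π i a (J i x) = J i ((F i Y).rep.hom a x) := by
  classical
  let W : Type uI := {w : List I // w.IsChain (· ≠ ·)}
  let X (w : List I) : HilbertRep.{uK} B := wordRep Y F w
  obtain ⟨K, _, _, _, s, hs, hsd⟩ := exists_hilbert_sum fun w : W => (X w.1).space
  obtain ⟨τ, hτ⟩ := exists_rep_directSum s hs hsd fun w => (X w.1).hom
  -- Reduced words not beginning with `i`: each indexes one pair `tl i w`, `cn i w` of summands.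
  let V (i : I) : Type uI := {w : List I // (i :: w).IsChain (· ≠ ·)}
  let tl (i : I) (w : V i) : W := ⟨w.1, w.2.tail⟩
  let cn (i : I) (w : V i) : W := ⟨i :: w.1, w.2⟩
  have hne (i : I) (w w' : V i) : tl i w ≠ cn i w' := fun h => by
    have h1 : w.1 = i :: w'.1 := congrArg Subtype.val h
    have h2 := w.2
    rw [h1, List.isChain_cons_cons] at h2
    exact h2.1 rfl
  -- Type-correct because `wordRep` at `i :: w` is by definition this complement.
  let t (i : I) (w : V i) : (F i (X w.1)).compl.space →ₗᵢ[ℂ] K := s (cn i w)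
  have hJ (i : I) (w : V i) := (F i (X w.1)).exists_isometry (s (tl i w)) (t i w)
    fun y c => hs (hne i w w) y c
  choose J hJ1 hJ2 using hJ
  have horth (i : I) : OrthogonalFamily ℂ (fun w : V i => (F i (X w.1)).rep.space) (J i) := by
    intro w w' hww x x'
    obtain ⟨y, c, rfl⟩ := (F i (X w.1)).exists_add x
    obtain ⟨y', c', rfl⟩ := (F i (X w'.1)).exists_add x'
    have h1 : tl i w ≠ tl i w' := fun h => hww (Subtype.ext (congrArg (fun u : W => u.1) h))
    have h2 : cn i w ≠ cn i w' := fun h =>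
      hww (Subtype.ext (List.cons_injective (congrArg Subtype.val h)))
    have e1 : ⟪s (tl i w) y, s (tl i w') y'⟫_ℂ = 0 := hs h1 y y'
    have e2 : ⟪s (tl i w) y, t i w' c'⟫_ℂ = 0 := hs (hne i w w') y c'
    have e3 : ⟪t i w c, s (tl i w') y'⟫_ℂ = 0 := hs (hne i w' w).symm c y'
    have e4 : ⟪t i w c, t i w' c'⟫_ℂ = 0 := hs h2 c c'
    rw [map_add, map_add, hJ1, hJ1, hJ2, hJ2, inner_add_left, inner_add_right, inner_add_right,
      e1, e2, e3, e4, add_zero, add_zero]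
  -- For fixed `i` the pairs exhaust all reduced words: either `i` can be prepended to `u`, or `u`
  -- begins with `i`.
  have hcases (i : I) (p : W → Prop) (h1 : ∀ w, p (tl i w)) (h2 : ∀ w, p (cn i w)) (u : W) :
      p u := by
    obtain ⟨u, hu⟩ := u
    by_cases h : (i :: u).IsChain (· ≠ ·)
    · exact h1 ⟨u, h⟩
    · cases u with
      | nil => exact absurd (List.isChain_singleton i) h
      | cons k w =>
        have hik : i = k := by
          by_contra hik
          exact h (List.isChain_cons_cons.mpr ⟨hik, hu⟩)
        subst hik
        exact h2 ⟨w, hu⟩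
  have hdense (i : I) :
      (⨆ w : V i, LinearMap.range (J i w).toLinearMap).topologicalClosure = ⊤ := by
    rw [eq_top_iff, ← hsd]
    refine Submodule.topologicalClosure_mono (iSup_le fun u => ?_)
    refine hcases i (fun u => LinearMap.range (s u).toLinearMap ≤ _) (fun w => ?_) (fun w => ?_) u
    · rintro _ ⟨y, rfl⟩
      exact Submodule.mem_iSup_of_mem w ⟨_, hJ1 i w y⟩
    · rintro _ ⟨c, rfl⟩
      exact Submodule.mem_iSup_of_mem w ⟨_, hJ2 i w c⟩
  choose π hπ using fun i => exists_rep_directSum (J i) (horth i) (hdense i)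
    fun w => (F i (X w.1)).rep.hom
  have hnil (i : I) : ([i] : List I).IsChain (· ≠ ·) := List.isChain_singleton i
  refine ⟨⟨K, τ⟩, π, s ⟨[], List.isChain_nil⟩, fun i => J i ⟨[], hnil i⟩, fun i b => ?_,
    fun i y => hJ1 i ⟨[], hnil i⟩ y, fun i a x => hπ i a ⟨[], hnil i⟩ x⟩
  -- Each summand reduces the restriction of `π i` to `B`, as the embedded part or as the complement
  -- of a dilation, and in both cases `B` acts as in `X u`, whatever `i` is.
  refine ext_of_iSup_range hsd fun u => ?_
  refine hcases i (fun u => ∀ y, π i (ε i b) (s u y) = τ b (s u y)) (fun w y => ?_)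
    (fun w c => ?_) u
  · rw [hτ, ← hJ1, hπ, (F i (X w.1)).map_embed, hJ1]
  · have h1 : s (cn i w) c = J i w ((F i (X w.1)).complEmbed c) := (hJ2 i w c).symm
    have h2 : s (cn i w) ((X (cn i w).1).hom b c) =
      J i w ((F i (X w.1)).complEmbed ((F i (X w.1)).compl.hom b c)) := (hJ2 i w _).symm
    rw [hτ, h1, h2, hπ]
    exact congrArg (J i w) ((F i (X w.1)).map_complEmbed b c)

end Glue

/-! ### Compressions and change of universe. -/

/-- Compressions of representations are completely positive. -/
theorem exists_compression {C : Type uA} [CStarAlgebra C] [PartialOrder C] [StarOrderedRing C]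
    {H : Type uH} [NormedAddCommGroup H] [InnerProductSpace ℂ H] [CompleteSpace H]
    {K : Type uK} [NormedAddCommGroup K] [InnerProductSpace ℂ K] [CompleteSpace K]
    (π : C →⋆ₐ[ℂ] (K →L[ℂ] K)) (V : H →ₗᵢ[ℂ] K) :
    ∃ Ψ : C →CP (H →L[ℂ] H), ∀ c h h', ⟪h, Ψ c h'⟫_ℂ = ⟪V h, π c (V h')⟫_ℂ := by
  let W : H →L[ℂ] K := V.toContinuousLinearMap
  let T : C →ₗ[ℂ] (H →L[ℂ] H) :=
    { toFun := fun c => W.adjoint ∘L π c ∘L W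
      map_add' := fun c d => by ext h; simp
      map_smul' := fun z c => by ext h; simp }
  have hT c h h' : ⟪h, T c h'⟫_ℂ = ⟪V h, π c (V h')⟫_ℂ :=
    ContinuousLinearMap.adjoint_inner_right W h (π c (W h'))
  have hstar c : star (T c) = T (star c) := by
    refine ContinuousLinearMap.ext fun h => ext_inner_left ℂ fun h' => ?_
    rw [ContinuousLinearMap.star_eq_adjoint, ContinuousLinearMap.adjoint_inner_right, hT,
      ← inner_conj_symm, hT, inner_conj_symm]
    exact (⟨K, π⟩ : HilbertRep C).inner_hom_left c (V h') (V h)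
  refine ⟨⟨T, fun k M hM => ?_⟩, hT⟩
  refine nonneg_of_re_inner_opMulVec ?_ fun v => ?_
  · refine CStarMatrix.ext fun i j => ?_
    rw [CStarMatrix.star_apply, CStarMatrix.map_apply, CStarMatrix.map_apply, hstar]
    exact congrArg T (congrFun (congrFun hM.isSelfAdjoint.star_eq i) j)
  · have h1 : 0 ≤ M.map π :=
      CompletelyPositiveMapClass.map_cstarMatrix_nonneg' (A₁ := C) (A₂ := K →L[ℂ] K) π k M hM
    -- The quadratic form of the compressed matrix at `v` is that of `M.map π` at `V v`.
    have h2 i : ⟪v i, opMulVec (M.map T) v i⟫_ℂ =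
        ⟪V (v i), opMulVec (M.map π) (fun i => V (v i)) i⟫_ℂ := by
      rw [opMulVec, opMulVec, inner_sum, inner_sum]
      exact Finset.sum_congr rfl fun j _ => hT _ _ _
    have h3 := re_inner_opMulVec_nonneg h1 fun i => V (v i)
    rwa [← Finset.sum_congr rfl fun i _ => h2 i] at h3

theorem exists_universe_lift (H : Type uH) [NormedAddCommGroup H] [InnerProductSpace ℂ H]
    [CompleteSpace H] :
    ∃ (K : Type (max uA uH)) (_ : NormedAddCommGroup K) (_ : InnerProductSpace ℂ K)
      (_ : CompleteSpace K), Nonempty (H ≃ₗᵢ[ℂ] K) := by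
  -- A Hilbert sum with a single summand, indexed by a point in the larger universe.
  obtain ⟨K, _, _, _, J, -, hd⟩ := exists_hilbert_sum fun _ : PUnit.{uA + 1} => H
  refine ⟨K, inferInstance, inferInstance, inferInstance,
    ⟨LinearIsometryEquiv.ofSurjective (J PUnit.unit) fun k => ?_⟩⟩
  have hcl : IsClosed (LinearMap.range (J PUnit.unit).toLinearMap : Set K) :=
    (J PUnit.unit).isometry.isClosedEmbedding.isClosed_range
  rw [iSup_unique, hcl.submodule_topologicalClosure_eq] at hd
  exact (hd ▸ Submodule.mem_top : k ∈ LinearMap.range (J PUnit.unit).toLinearMap)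

/-! ### Representations of the free product. -/

section FreeProduct

variable {I : Type uI} {B : Type uB} [CStarAlgebra B] {A : I → Type uA}
  [∀ i, CStarAlgebra (A i)] {ε : ∀ i, B →⋆ₐ[ℂ] A i}

/-- Unital completely positive maps that restrict to a common representation of `B` have
simultaneous dilations that agree on `B`. -/
theorem exists_simultaneous_dilation [∀ i, PartialOrder (A i)] [∀ i, StarOrderedRing (A i)]
    (hε : ∀ i, Function.Injective (ε i)) {H : Type uH} [NormedAddCommGroup H]
    [InnerProductSpace ℂ H] [CompleteSpace H] (Φ : ∀ i, A i →CP (H →L[ℂ] H))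
    (hΦ : ∀ i, Φ i 1 = 1) (ρ : B →⋆ₐ[ℂ] (H →L[ℂ] H)) (hρ : ∀ i b, Φ i (ε i b) = ρ b) :
    ∃ (K : HilbertRep.{max uI uA uH} B) (π : ∀ i, A i →⋆ₐ[ℂ] (K.space →L[ℂ] K.space))
      (V : H →ₗᵢ[ℂ] K.space), (∀ i b, π i (ε i b) = K.hom b) ∧
      ∀ i a h h', ⟪V h, π i a (V h')⟫_ℂ = ⟪h, Φ i a h'⟫_ℂ := by
  classical
  -- The recursion over words needs one universe stable under dilation; `max uA uH` is stable and
  -- contains the Stinespring spaces, so `ρ` is moved there.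
  obtain ⟨L, _, _, _, ⟨e⟩⟩ := exists_universe_lift.{uA} H
  obtain ⟨σ, hσ⟩ := exists_rep_restrict ρ e.symm.toLinearIsometry
    fun b y => ⟨e (ρ b (e.symm y)), (e.symm_apply_apply _).symm⟩
  let Y : HilbertRep.{max uA uH} B := ⟨L, σ⟩
  choose P V hV using fun i => exists_stinespring (Φ i) (hΦ i)
  have hD i := exists_dilation (ε i) Y (P i) ((V i).comp e.symm.toLinearIsometry) fun b y =>
    (congrArg (V i) (hσ b y)).trans
      (dilation_equivariant (ε i) (Φ i) ρ (hρ i) (P i) (V i) (hV i) b (e.symm y))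
  have hE i (X : HilbertRep.{max uA uH} B) : Nonempty (Dilation (ε i) X) := by
    obtain ⟨Q, W, hW⟩ := exists_extension_rep (ε i) (hε i) X
    obtain ⟨D, -⟩ := exists_dilation (ε i) X Q W hW
    exact ⟨D⟩
  choose D U hU1 hU2 using hD
  -- At `Y` the Stinespring dilation is prescribed; elsewhere any dilation serves. Should `Y` recur
  -- at a longer word, the prescribed one is just as good.
  let F i : ∀ X : HilbertRep.{max uA uH} B, Dilation (ε i) X :=
    Function.update (fun X => (hE i X).some) Y (D i)
  have hF i : ∃ U : (P i).space →ₗᵢ[ℂ] (F i Y).rep.space,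
      (∀ y, (F i Y).embed y = U (V i (e.symm y))) ∧
      ∀ a x, U ((P i).hom a x) = (F i Y).rep.hom a (U x) := by
    have h : F i Y = D i := Function.update_self _ _ _
    rw [h]
    exact ⟨U i, hU1 i, hU2 i⟩
  obtain ⟨K, π, s, J, hπ, hJ, hJπ⟩ := exists_glued_reps Y F
  refine ⟨K, π, s.comp e.toLinearIsometry, hπ, fun i a h h' => ?_⟩
  obtain ⟨U, hU, hUP⟩ := hF i
  have hs (h : H) : s (e h) = J i (U (V i h)) := by
    have h1 := hJ i (e h)
    rw [hU, e.symm_apply_apply] at h1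
    exact h1.symm
  change ⟪s (e h), π i a (s (e h'))⟫_ℂ = _
  rw [hs, hs, hJπ, ← hUP, (J i).inner_map_map, U.inner_map_map, hV]

/-- The universal property of the algebraic amalgamated free product. -/
theorem exists_rep_algAmalg (K : HilbertRep.{uK} B)
    (π : ∀ i, A i →⋆ₐ[ℂ] (K.space →L[ℂ] K.space)) (hπ : ∀ i b, π i (ε i b) = K.hom b) :
    ∃ σ : AlgAmalg ε →⋆ₐ[ℂ] (K.space →L[ℂ] K.space), ∀ i a, σ (algOf ε i a) = π i a := by
  let f : Pre ε →ₐ[ℂ] (K.space →L[ℂ] K.space) :=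
    FreeAlgebra.lift ℂ (Sum.elim K.hom fun s => π s.1 s.2)
  have hB b : f (genB ε b) = K.hom b := FreeAlgebra.lift_ι_apply _ _
  have hA i a : f (genA ε i a) = π i a := FreeAlgebra.lift_ι_apply _ _
  have hrel {x y : Pre ε} (h : Rel ε x y) : f x = f y := by
    cases h with
    | algebraMapB z => rw [hB, AlgHom.commutes, AlgHomClass.commutes]
    | addB b c => rw [map_add, hB, hB, hB, map_add]
    | mulB b c => rw [map_mul, hB, hB, hB, map_mul]
    | algebraMapA i z => rw [hA, AlgHom.commutes, AlgHomClass.commutes]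
    | addA i a c => rw [map_add, hA, hA, hA, map_add]
    | mulA i a c => rw [map_mul, hA, hA, hA, map_mul]
    | amalg i b => rw [hA, hB, hπ]
  let g : AlgAmalg ε →ₐ[ℂ] (K.space →L[ℂ] K.space) :=
    RingQuot.liftAlgHom ℂ ⟨f, fun _ _ h => hrel h⟩
  have hg x : g (mk ε x) = f x := RingQuot.liftAlgHom_mkAlgHom_apply ℂ _ _ x
  have hgB b : g (algOfB ε b) = K.hom b := (hg _).trans (hB b)
  have hgA i a : g (algOf ε i a) = π i a := (hg _).trans (hA i a)
  refine ⟨{ g with map_star' := fun x => ?_ }, hgA⟩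
  change g (star x) = star (g x)
  induction x using AlgAmalg.induction with
  | scalar z => rw [star_algebraMap', AlgHom.commutes, AlgHom.commutes, algebraMap_star_comm]
  | ofB b => rw [star_algOfB, hgB, hgB, map_star]
  | ofA i a => rw [star_algOf, hgA, hgA, map_star]
  | mul x y hx hy => rw [star_mul, map_mul, map_mul, hx, hy, star_mul]
  | add x y hx hy => rw [star_add, map_add, map_add, hx, hy, star_add]

/-- The universal seminorm dominates representations on Hilbert spaces in any universe. -/
theorem norm_hom_le (P : HilbertRep.{uK} (AlgAmalg ε)) (x : AlgAmalg ε) : ‖P.hom x‖ ≤ ‖x‖ := by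
  refine ContinuousLinearMap.opNorm_le_bound _ (norm_nonneg _) fun ξ => ?_
  -- The seminorm only sees spaces in one universe. The Gram kernel of the orbit of `ξ` rebuilds its
  -- cyclic subspace in that universe, and the norm estimate at `ξ` takes place there.
  obtain ⟨S, _, _, _, j, hj, hd⟩ := exists_space_of_kernel
    (fun x y : AlgAmalg ε => (⟪P.hom x ξ, P.hom y ξ⟫_ℂ • 1 : ℂ →L[ℂ] ℂ))
    (fun x y => by rw [star_smul, star_one, ← inner_conj_symm (P.hom y ξ)]; rfl)
    (fun f => by
      have h : 0 ≤ (⟪Finsupp.linearCombination ℂ (fun x => P.hom x ξ) f,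
          Finsupp.linearCombination ℂ (fun x => P.hom x ξ) f⟫_ℂ).re :=
        inner_self_nonneg (𝕜 := ℂ)
      rw [inner_linearCombination] at h
      refine h.trans_eq (congrArg Complex.re
        (Finsupp.sum_congr fun x _ => Finsupp.sum_congr fun y _ => ?_))
      rw [← inner_conj_symm (P.hom x ξ)]
      simp [mul_comm, mul_left_comm, mul_assoc])
  obtain ⟨W, hW⟩ := exists_isometry_of_inner_eq (fun p : AlgAmalg ε × ℂ => j p.1 p.2)
    (fun p => p.2 • P.hom p.1 ξ) hd (by
      rintro ⟨x, v⟩ ⟨y, w⟩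
      change ⟪j x v, j y w⟫_ℂ = ⟪v • P.hom x ξ, w • P.hom y ξ⟫_ℂ
      rw [hj, inner_smul_left, inner_smul_right]
      simp [mul_comm, mul_left_comm])
  have hW' x v : W (j x v) = v • P.hom x ξ := hW (x, v)
  have hcl : IsClosed (LinearMap.range W.toLinearMap : Set P.space) :=
    W.isometry.isClosedEmbedding.isClosed_range
  obtain ⟨σ, hσ⟩ := exists_rep_restrict P.hom W fun r y => by
    let G : S →L[ℂ] P.space := P.hom r ∘L W.toContinuousLinearMap
    let N : Submodule ℂ S := (LinearMap.range W.toLinearMap).comap G.toLinearMap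
    have hN : IsClosed (N : Set S) := hcl.preimage G.continuous
    -- The vectors that `P.hom r` keeps in the range of `W` form a closed subspace containing the
    -- total family, hence everything.
    have h1 : (⊤ : Submodule ℂ S) ≤ N := by
      rw [← hd]
      refine Submodule.topologicalClosure_minimal _ (Submodule.span_le.mpr ?_) hN
      rintro _ ⟨⟨z, v⟩, rfl⟩
      refine ⟨j (r * z) v, ?_⟩
      change W (j (r * z) v) = P.hom r (W (j z v))
      rw [hW', hW', map_smul, P.hom_mul_apply]
    obtain ⟨z, hz⟩ := h1 (Submodule.mem_top : y ∈ ⊤)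
    exact ⟨z, hz.symm⟩
  let R : Rep ε := ⟨S, σ⟩
  have hξ : ξ = W (j 1 1) := by rw [hW', one_smul, map_one]; rfl
  calc ‖P.hom x ξ‖ = ‖W (σ x (j 1 1))‖ := by rw [hσ, ← hξ]
    _ = ‖σ x (j 1 1)‖ := W.norm_map _
    _ ≤ ‖σ x‖ * ‖j 1 1‖ := (σ x).le_opNorm _
    _ ≤ ‖x‖ * ‖j 1 1‖ := mul_le_mul_of_nonneg_right (norm_rep_le ε R x) (norm_nonneg _)
    _ = ‖x‖ * ‖ξ‖ := by rw [← W.norm_map, ← hξ]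

theorem exists_extension_freeProd (P : HilbertRep.{uK} (AlgAmalg ε)) :
    ∃ T : FreeProd ε →L[ℂ] (P.space →L[ℂ] P.space), ∀ x, T (toFreeProd ε x) = P.hom x := by
  let f : AlgAmalg ε →ₗ[ℂ] (P.space →L[ℂ] P.space) := P.hom.toAlgHom.toLinearMap
  refine ⟨f.extendOfNorm (toFreeProd ε).toLinearMap, fun x =>
    LinearMap.extendOfNorm_eq (f := f) (e := (toFreeProd ε).toLinearMap)
      (denseRange_toFreeProd ε) ⟨1, fun x => ?_⟩ x⟩
  have h := norm_hom_le P x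
  rw [← norm_toFreeProd, ← one_mul ‖toFreeProd ε x‖] at h
  exact h

/-- Representations of the algebraic amalgamated free product extend to the C*-algebra. -/
theorem exists_rep_freeProd (P : HilbertRep.{uK} (AlgAmalg ε)) :
    ∃ σ : FreeProd ε →⋆ₐ[ℂ] (P.space →L[ℂ] P.space), ∀ x, σ (toFreeProd ε x) = P.hom x := by
  have hd := denseRange_toFreeProd ε
  obtain ⟨T, hT⟩ := exists_extension_freeProd P
  have hone : T 1 = 1 := by rw [← map_one (toFreeProd ε), hT, map_one]
  have hmul x y : T (x * y) = T x * T y := by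
    induction x, y using hd.induction_on₂ with
    | hp => exact isClosed_eq (by fun_prop) (by fun_prop)
    | h x y => rw [← map_mul, hT, hT, hT, map_mul]
  have hstar x : T (star x) = star (T x) := by
    induction x using hd.induction_on with
    | hp =>
      exact isClosed_eq (T.continuous.comp (continuous_star' ε)) (continuous_star.comp T.continuous)
    | ih x => rw [star_toFreeProd, hT, hT, map_star]
  exact ⟨{ toFun := T
           map_one' := hone
           map_mul' := hmul
           map_zero' := map_zero T
           map_add' := map_add T
           commutes' := fun z => by
             rw [Algebra.algebraMap_eq_smul_one, map_smul, hone, Algebra.algebraMap_eq_smul_one]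
           map_star' := hstar }, hT⟩

end FreeProduct

end CStarAmalgam

end

/-! ### The theorem. -/

open scoped CStarAlgebra in
theorem theorem3p1 {I : Type uI} {B : Type uB} [CStarAlgebra B]
    {A : I → Type uA} [∀ i, CStarAlgebra (A i)]
    [∀ i, PartialOrder (A i)] [∀ i, StarOrderedRing (A i)]
    (ε : ∀ i, B →⋆ₐ[ℂ] A i) (hε : ∀ i, Function.Injective (ε i))
    {H : Type uH} [NormedAddCommGroup H] [InnerProductSpace ℂ H] [CompleteSpace H]
    (Φ : ∀ i, A i →CP (H →L[ℂ] H)) (hΦ : ∀ i, Φ i 1 = 1)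
    (ρ : B →⋆ₐ[ℂ] (H →L[ℂ] H)) (hρ : ∀ i b, Φ i (ε i b) = ρ b) :
    ∃ Ψ : CStarAmalgam.FreeProd ε →CP (H →L[ℂ] H),
      Ψ 1 = 1 ∧ ∀ i a, Ψ (CStarAmalgam.of ε i a) = Φ i a := by
  obtain ⟨K, π, V, hπ, hV⟩ := CStarAmalgam.exists_simultaneous_dilation hε Φ hΦ ρ hρ
  obtain ⟨τ, hτ⟩ := CStarAmalgam.exists_rep_algAmalg K π hπ
  obtain ⟨σ, hσ⟩ := CStarAmalgam.exists_rep_freeProd ⟨K.space, τ⟩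
  obtain ⟨Ψ, hΨ⟩ := CStarAmalgam.exists_compression σ V
  refine ⟨Ψ, ?_, fun i a => ?_⟩
  · refine ContinuousLinearMap.ext fun h => ext_inner_left ℂ fun h' => ?_
    rw [hΨ, map_one]
    exact V.inner_map_map h' h
  · refine ContinuousLinearMap.ext fun h => ext_inner_left ℂ fun h' => ?_
    have h1 : σ (CStarAmalgam.of ε i a) = π i a := (hσ _).trans (hτ i a)
    rw [hΨ, h1, hV]
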